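/- All links are oriented. A twisted link diagram is a generic link diagram in $\mathbb{R}^2$ whose double points are either classical crossings (with over/under information) or virtual crossings (without), possibly with bars (short transverse segments) on its arcs; a virtual link diagram is a twisted link diagram without bars. A virtual link is an equivalence class of virtual link diagrams under isotopy of $\mathbb{R}^2$, the classical Reidemeister moves R1, R2, R3 and the virtual Reidemeister moves V1–V4 (V1–V3 are R1–R3 with all crossings virtual; in V4 a strand with two virtual crossings passes across a classical crossing). A twisted link is an equivalence class of twisted link diagrams under all these moves together with the twisted moves T1 (a bar passes through a virtual crossing), T2 (two consecutive bars on an arc cancel) and T3 (a classical crossing with a bar on each of its four legs is replaced by the crossing obtained from it by turning it over, placed between two virtual crossings). A knot is a link with exactly one component. For a virtual link $L$ with diagram $D$, let $s(L)$ be the virtual link represented by the diagram $s(D)$ obtained from $D$ by a reflection along a line in $\mathbb{R}^2$ followed by switching the over/under information at all classical crossings. Theorem. Two virtual knots $L$ and $L'$ are equivalent as twisted links if and only if $L'$ is equivalent, as a virtual knot, to $L$ or to $s(L)$. -/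

import Mathlib

/-!
Oriented twisted link diagrams in the plane, presented in general position with respect to the
height function: a diagram is a stack of standard pieces, read from bottom to top.  Each piece is a
horizontal slab that contains exactly one event (a maximal point, a minimal point, a classical
crossing, a virtual crossing or a bar) together with vertical strands to its left and to its right.
Isotopies of the plane are generated by the usual moves of such stacks.
-/

namespace TwistedLinks

/-- The direction in which an oriented strand crosses a horizontal line. -/
inductive Dir
  | up
  | down

/-- The opposite direction. -/
def Dir.flip : Dir → Dir
  | .up => .down
  | .down => .up

/-- The events of a diagram.  The directions are those of the strands entering from below, from
left to right, except for `min d`, where `d` is the direction of the left one of the two strands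
leaving upwards.
In `cross s p q` the over-strand is the one running from bottom left to top right if `s = true`,
and the one running from bottom right to top left if `s = false`. -/
inductive Event
  | max (d : Dir)
  | min (d : Dir)
  | cross (s : Bool) (p q : Dir)
  | virt (p q : Dir)
  | bar (d : Dir)

namespace Event

/-- Strands entering an event from below, from left to right. -/
def bot : Event → List Dir
  | max d => [d, d.flip]
  | min _ => []
  | cross _ p q => [p, q]
  | virt p q => [p, q]
  | bar d => [d]

/-- Strands leaving an event upwards, from left to right. -/
def top : Event → List Dir
  | max _ => []
  | min d => [d, d.flip]
  | cross _ p q => [q, p]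
  | virt p q => [q, p]
  | bar d => [d]

/-- Reflection along a vertical line (over/under information is carried along by the strands). -/
def reflect : Event → Event
  | max d => max d.flip
  | min d => min d.flip
  | cross s p q => cross (!s) q p
  | virt p q => virt q p
  | bar d => bar d

/-- Switching the over/under information of a classical crossing. -/
def switch : Event → Event
  | cross s p q => cross (!s) p q
  | e => e

end Event

/-- A standard piece: an event with vertical strands on its left and on its right. -/
structure Piece where
  lft : List Dir
  event : Event
  rgt : List Dir

namespace Piece

/-- Strands on the lower boundary line of the slab. -/
def bot (p : Piece) : List Dir := p.lft ++ p.event.bot ++ p.rgt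

/-- Strands on the upper boundary line of the slab. -/
def top (p : Piece) : List Dir := p.lft ++ p.event.top ++ p.rgt

/-- Adding further vertical strands on both sides. -/
def pad (l r : List Dir) (p : Piece) : Piece := ⟨l ++ p.lft, p.event, p.rgt ++ r⟩

def reflect (p : Piece) : Piece := ⟨p.rgt.reverse, p.event.reflect, p.lft.reverse⟩

def switch (p : Piece) : Piece := ⟨p.lft, p.event.switch, p.rgt⟩

/-- `Joins k p x y`: the piece `p`, occupying the slab between the horizontal lines `k` and `k + 1`,
contains an arc with end points `x` and `y`.  Here `(k, j)` is the point where the `j`-th strand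
(from the left, starting with `0`) meets the line `k`.  Arcs run straight through crossings. -/
inductive Joins (k : ℕ) : Piece → ℕ × ℕ → ℕ × ℕ → Prop
  | lft (l e r) (j : ℕ) (hj : j < l.length) : Joins k ⟨l, e, r⟩ (k, j) (k + 1, j)
  | rgt (l e r) (j : ℕ) (hj : j < r.length) :
      Joins k ⟨l, e, r⟩ (k, l.length + e.bot.length + j) (k + 1, l.length + e.top.length + j)
  | max (l d r) : Joins k ⟨l, .max d, r⟩ (k, l.length) (k, l.length + 1)
  | min (l d r) : Joins k ⟨l, .min d, r⟩ (k + 1, l.length) (k + 1, l.length + 1)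
  | cross_ne (l s p q r) : Joins k ⟨l, .cross s p q, r⟩ (k, l.length) (k + 1, l.length + 1)
  | cross_nw (l s p q r) : Joins k ⟨l, .cross s p q, r⟩ (k, l.length + 1) (k + 1, l.length)
  | virt_ne (l p q r) : Joins k ⟨l, .virt p q, r⟩ (k, l.length) (k + 1, l.length + 1)
  | virt_nw (l p q r) : Joins k ⟨l, .virt p q, r⟩ (k, l.length + 1) (k + 1, l.length)
  | bar (l d r) : Joins k ⟨l, .bar d, r⟩ (k, l.length) (k + 1, l.length)

end Piece

/-- `Fits s w t`: the pieces of `w`, stacked from bottom to top, fit together to an oriented tangle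
diagram with strands `s` on its lower and `t` on its upper boundary line. -/
def Fits : List Dir → List Piece → List Dir → Prop
  | s, [], t => s = t
  | s, p :: w, t => p.bot = s ∧ Fits p.top w t

/-- Oriented twisted link diagrams in the plane. -/
structure TwistedDiagram where
  word : List Piece
  closed : Fits [] word []

/-- Oriented virtual link diagrams: twisted link diagrams without bars. -/
structure VirtualDiagram extends TwistedDiagram where
  no_bar : ∀ p ∈ word, ∀ d, p.event ≠ .bar d

/-! ### Components -/

/-- The intersection points of a diagram with the horizontal lines between its slabs. -/
def TwistedDiagram.Point (D : TwistedDiagram) : Type :=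
  {x : ℕ × ℕ // ∃ p : Piece, D.word[x.1]? = some p ∧ x.2 < p.bot.length}

/-- The components of the link, that is, the points modulo being joined by arcs of the diagram. -/
def TwistedDiagram.Component (D : TwistedDiagram) : Type :=
  Quot fun x y : D.Point => ∃ (k : ℕ) (p : Piece), D.word[k]? = some p ∧ p.Joins k x.1 y.1

/-- A knot diagram: the link has exactly one component. -/
def TwistedDiagram.IsKnot (D : TwistedDiagram) : Prop := Nat.card D.Component = 1

/-! ### Moves

The moves are stated for tangle diagrams with as few strands as possible, for all orientations of
the strands. -/

/-- Isotopies of the plane: events at different places exchange their heights; a maximal and an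
adjacent minimal point cancel; a maximal or minimal point slides through a crossing (classical or
virtual); a bar slides over a maximal or minimal point. -/
inductive Isotopy : List Piece → List Piece → Prop
  | exchange (e f : Event) (m : List Dir) : Isotopy
      [⟨[], e, m ++ f.bot⟩, ⟨e.top ++ m, f, []⟩] [⟨e.bot ++ m, f, []⟩, ⟨[], e, m ++ f.top⟩]
  | zigzag_left (d : Dir) : Isotopy
      [⟨[d], .min d.flip, []⟩, ⟨[], .max d, [d]⟩] []
  | zigzag_right (d : Dir) : Isotopy
      [⟨[], .min d, [d]⟩, ⟨[d], .max d.flip, []⟩] []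
  | max_cross (s : Bool) (p q : Dir) : Isotopy
      [⟨[p], .cross s q p.flip, []⟩, ⟨[], .max p, [q]⟩]
      [⟨[], .cross (!s) p q, [p.flip]⟩, ⟨[q], .max p, []⟩]
  | min_cross (s : Bool) (p q : Dir) : Isotopy
      [⟨[], .min p, [q]⟩, ⟨[p], .cross s p.flip q, []⟩]
      [⟨[q], .min p, []⟩, ⟨[], .cross (!s) q p, [p.flip]⟩]
  | max_virt (p q : Dir) : Isotopy
      [⟨[p], .virt q p.flip, []⟩, ⟨[], .max p, [q]⟩]
      [⟨[], .virt p q, [p.flip]⟩, ⟨[q], .max p, []⟩]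
  | min_virt (p q : Dir) : Isotopy
      [⟨[], .min p, [q]⟩, ⟨[p], .virt p.flip q, []⟩]
      [⟨[q], .min p, []⟩, ⟨[], .virt q p, [p.flip]⟩]
  | max_bar (d : Dir) : Isotopy
      [⟨[], .bar d, [d.flip]⟩, ⟨[], .max d, []⟩] [⟨[d], .bar d.flip, []⟩, ⟨[], .max d, []⟩]
  | min_bar (d : Dir) : Isotopy
      [⟨[], .min d, []⟩, ⟨[], .bar d, [d.flip]⟩] [⟨[], .min d, []⟩, ⟨[d], .bar d.flip, []⟩]

/-- The classical Reidemeister moves R1 (kinks of both kinds, on both sides), R2 and R3.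
In R3 the condition says that the three strands lie at three different heights, that is, the
relation of crossing over is not cyclic. -/
inductive ClassicalMove : List Piece → List Piece → Prop
  | R1_right (s : Bool) (d : Dir) : ClassicalMove
      [⟨[d], .min d, []⟩, ⟨[], .cross s d d, [d.flip]⟩, ⟨[d], .max d, []⟩] []
  | R1_left (s : Bool) (d : Dir) : ClassicalMove
      [⟨[], .min d.flip, [d]⟩, ⟨[d.flip], .cross s d d, []⟩, ⟨[], .max d.flip, [d]⟩] []
  | R2 (s : Bool) (p q : Dir) : ClassicalMove
      [⟨[], .cross s p q, []⟩, ⟨[], .cross (!s) q p, []⟩] []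
  | R3 (a b c : Bool) (h : a = c → b = a) (p q r : Dir) : ClassicalMove
      [⟨[], .cross a p q, [r]⟩, ⟨[q], .cross b p r, []⟩, ⟨[], .cross c q r, [p]⟩]
      [⟨[p], .cross c q r, []⟩, ⟨[], .cross b p r, [q]⟩, ⟨[r], .cross a p q, []⟩]

/-- The virtual Reidemeister moves V1, V2, V3 and V4. -/
inductive VirtualMove : List Piece → List Piece → Prop
  | V1_right (d : Dir) : VirtualMove
      [⟨[d], .min d, []⟩, ⟨[], .virt d d, [d.flip]⟩, ⟨[d], .max d, []⟩] []
  | V1_left (d : Dir) : VirtualMove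
      [⟨[], .min d.flip, [d]⟩, ⟨[d.flip], .virt d d, []⟩, ⟨[], .max d.flip, [d]⟩] []
  | V2 (p q : Dir) : VirtualMove
      [⟨[], .virt p q, []⟩, ⟨[], .virt q p, []⟩] []
  | V3 (p q r : Dir) : VirtualMove
      [⟨[], .virt p q, [r]⟩, ⟨[q], .virt p r, []⟩, ⟨[], .virt q r, [p]⟩]
      [⟨[p], .virt q r, []⟩, ⟨[], .virt p r, [q]⟩, ⟨[r], .virt p q, []⟩]
  | V4_left (s : Bool) (p q r : Dir) : VirtualMove
      [⟨[], .cross s p q, [r]⟩, ⟨[q], .virt p r, []⟩, ⟨[], .virt q r, [p]⟩]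
      [⟨[p], .virt q r, []⟩, ⟨[], .virt p r, [q]⟩, ⟨[r], .cross s p q, []⟩]
  | V4_right (s : Bool) (p q r : Dir) : VirtualMove
      [⟨[], .virt p q, [r]⟩, ⟨[q], .virt p r, []⟩, ⟨[], .cross s q r, [p]⟩]
      [⟨[p], .cross s q r, []⟩, ⟨[], .virt p r, [q]⟩, ⟨[r], .virt p q, []⟩]

/-- The twisted Reidemeister moves: a bar passes through a virtual crossing (T1); two consecutive
bars cancel (T2); a classical crossing with a bar on each of its four legs is replaced by a
classical crossing between two virtual crossings (T3). -/
inductive TwistedMove : List Piece → List Piece → Prop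
  | T1_left (p q : Dir) : TwistedMove
      [⟨[], .bar p, [q]⟩, ⟨[], .virt p q, []⟩] [⟨[], .virt p q, []⟩, ⟨[q], .bar p, []⟩]
  | T1_right (p q : Dir) : TwistedMove
      [⟨[p], .bar q, []⟩, ⟨[], .virt p q, []⟩] [⟨[], .virt p q, []⟩, ⟨[], .bar q, [p]⟩]
  | T2 (d : Dir) : TwistedMove
      [⟨[], .bar d, []⟩, ⟨[], .bar d, []⟩] []
  | T3 (s : Bool) (p q : Dir) : TwistedMove
      [⟨[], .bar p, [q]⟩, ⟨[p], .bar q, []⟩, ⟨[], .cross s p q, []⟩,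
        ⟨[], .bar q, [p]⟩, ⟨[q], .bar p, []⟩]
      [⟨[], .virt p q, []⟩, ⟨[], .cross s q p, []⟩, ⟨[], .virt p q, []⟩]

/-- Applying a move `M` locally, inside a larger diagram. -/
def Local (M : List Piece → List Piece → Prop) (u v : List Piece) : Prop :=
  ∃ below above l r w w', M w w' ∧ u = below ++ w.map (Piece.pad l r) ++ above ∧
    v = below ++ w'.map (Piece.pad l r) ++ above

/-- Isotopies of the plane, classical and virtual Reidemeister moves. -/
def VirtualStep (D D' : VirtualDiagram) : Prop :=
  Local (Isotopy ⊔ ClassicalMove ⊔ VirtualMove) D.word D'.word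

/-- Isotopies of the plane and extended Reidemeister moves. -/
def TwistedStep (D D' : TwistedDiagram) : Prop :=
  Local (Isotopy ⊔ ClassicalMove ⊔ VirtualMove ⊔ TwistedMove) D.word D'.word

/-- Virtual links: virtual link diagrams modulo the equivalence relation generated by isotopies,
classical and virtual Reidemeister moves. -/
def VirtualLink : Type := Quot VirtualStep

/-- Twisted links: twisted link diagrams modulo the equivalence relation generated by isotopies and
extended Reidemeister moves. -/
def TwistedLink : Type := Quot TwistedStep

/-- A virtual knot is a virtual link represented by a diagram with exactly one component. -/
def VirtualLink.IsKnot (L : VirtualLink) : Prop :=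
  ∃ D : VirtualDiagram, D.IsKnot ∧ Quot.mk VirtualStep D = L

theorem VirtualStep.twistedStep {D D' : VirtualDiagram} (h : VirtualStep D D') :
    TwistedStep D.toTwistedDiagram D'.toTwistedDiagram := by
  obtain ⟨b, a, l, r, w, w', hM, h1, h2⟩ := h
  exact ⟨b, a, l, r, w, w', Or.inl hM, h1, h2⟩

/-- The natural map from virtual links to twisted links. -/
def VirtualLink.toTwisted : VirtualLink → TwistedLink :=
  Quot.map VirtualDiagram.toTwistedDiagram fun _ _ => VirtualStep.twistedStep

/-! ### The operation `s` -/

@[simp] theorem Dir.flip_flip (d : Dir) : d.flip.flip = d := by cases d <;> rfl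

theorem Piece.bot_reflect_switch (p : Piece) : p.reflect.switch.bot = p.bot.reverse := by
  rcases p with ⟨l, e, r⟩
  cases e <;>
    simp [Piece.reflect, Piece.switch, Piece.bot, Event.reflect, Event.switch, Event.bot]

theorem Piece.top_reflect_switch (p : Piece) : p.reflect.switch.top = p.top.reverse := by
  rcases p with ⟨l, e, r⟩
  cases e <;>
    simp [Piece.reflect, Piece.switch, Piece.top, Event.reflect, Event.switch, Event.top]

theorem Fits.reflect_switch {s t : List Dir} {w : List Piece} (h : Fits s w t) :
    Fits s.reverse (w.map fun p => p.reflect.switch) t.reverse := by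
  induction w generalizing s with
  | nil => exact congrArg List.reverse h
  | cons p w ih =>
    obtain ⟨h1, h2⟩ := h
    refine ⟨by rw [Piece.bot_reflect_switch, h1], ?_⟩
    rw [Piece.top_reflect_switch]
    exact ih h2

/-- `s(D)`: reflect the diagram along a vertical line, then switch the over/under information of
all classical crossings. -/
def TwistedDiagram.s (D : TwistedDiagram) : TwistedDiagram where
  word := D.word.map fun p => p.reflect.switch
  closed := by simpa using D.closed.reflect_switch

/-- `s(D)` for a virtual link diagram `D`. -/
def VirtualDiagram.s (D : VirtualDiagram) : VirtualDiagram where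
  toTwistedDiagram := D.toTwistedDiagram.s
  no_bar := by
    intro p hp d
    obtain ⟨p', hp', rfl⟩ := List.mem_map.1 hp
    have h := D.no_bar p' hp'
    rcases p' with ⟨l, e, r⟩
    cases e <;> simp_all [Piece.reflect, Piece.switch, Event.reflect, Event.switch]

theorem Piece.pad_reflect_switch (l r : List Dir) (p : Piece) :
    (p.pad l r).reflect.switch = (p.reflect.switch).pad r.reverse l.reverse := by
  simp [Piece.pad, Piece.reflect, Piece.switch]

theorem move_reflect_switch {w w' : List Piece}
    (h : (Isotopy ⊔ ClassicalMove ⊔ VirtualMove) w w') :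
    (Isotopy ⊔ ClassicalMove ⊔ VirtualMove) (w.map fun p => p.reflect.switch)
        (w'.map fun p => p.reflect.switch) ∨
      (Isotopy ⊔ ClassicalMove ⊔ VirtualMove) (w'.map fun p => p.reflect.switch)
        (w.map fun p => p.reflect.switch) := by
  rcases h with (h | h) | h
  · have key : Isotopy (w.map fun p => p.reflect.switch) (w'.map fun p => p.reflect.switch) ∨
        Isotopy (w'.map fun p => p.reflect.switch) (w.map fun p => p.reflect.switch) := by
      cases h with
      | exchange e f m =>
        right
        have h := Isotopy.exchange f.reflect.switch e.reflect.switch m.reverse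
        have b : ∀ e : Event, e.reflect.switch.bot = e.bot.reverse := by
          intro e; cases e <;> simp [Event.reflect, Event.switch, Event.bot]
        have t : ∀ e : Event, e.reflect.switch.top = e.top.reverse := by
          intro e; cases e <;> simp [Event.reflect, Event.switch, Event.top]
        simpa [Piece.reflect, Piece.switch, b, t] using h
      | zigzag_left d =>
        left
        simpa [Piece.reflect, Piece.switch, Event.reflect, Event.switch]
          using Isotopy.zigzag_right d
      | zigzag_right d =>
        left
        simpa [Piece.reflect, Piece.switch, Event.reflect, Event.switch]
          using Isotopy.zigzag_left d
      | max_cross s p q =>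
        right
        simpa [Piece.reflect, Piece.switch, Event.reflect, Event.switch]
          using Isotopy.max_cross (!s) p.flip q
      | min_cross s p q =>
        right
        simpa [Piece.reflect, Piece.switch, Event.reflect, Event.switch]
          using Isotopy.min_cross (!s) p.flip q
      | max_virt p q =>
        right
        simpa [Piece.reflect, Piece.switch, Event.reflect, Event.switch]
          using Isotopy.max_virt p.flip q
      | min_virt p q =>
        right
        simpa [Piece.reflect, Piece.switch, Event.reflect, Event.switch]
          using Isotopy.min_virt p.flip q
      | max_bar d =>
        right
        simpa [Piece.reflect, Piece.switch, Event.reflect, Event.switch]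
          using Isotopy.max_bar d.flip
      | min_bar d =>
        right
        simpa [Piece.reflect, Piece.switch, Event.reflect, Event.switch]
          using Isotopy.min_bar d.flip
    exact key.imp (fun h => Or.inl (Or.inl h)) (fun h => Or.inl (Or.inl h))
  · have key : ClassicalMove (w.map fun p => p.reflect.switch)
          (w'.map fun p => p.reflect.switch) ∨
        ClassicalMove (w'.map fun p => p.reflect.switch) (w.map fun p => p.reflect.switch) := by
      cases h with
      | R1_right s d =>
        left
        simpa [Piece.reflect, Piece.switch, Event.reflect, Event.switch]
          using ClassicalMove.R1_left s d
      | R1_left s d =>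
        left
        simpa [Piece.reflect, Piece.switch, Event.reflect, Event.switch]
          using ClassicalMove.R1_right s d
      | R2 s p q =>
        left
        simpa [Piece.reflect, Piece.switch, Event.reflect, Event.switch]
          using ClassicalMove.R2 s q p
      | R3 a b c h p q r =>
        right
        simpa [Piece.reflect, Piece.switch, Event.reflect, Event.switch]
          using ClassicalMove.R3 c b a (fun e => (h e.symm).trans e.symm) r q p
    exact key.imp (fun h => Or.inl (Or.inr h)) (fun h => Or.inl (Or.inr h))
  · have key : VirtualMove (w.map fun p => p.reflect.switch)
          (w'.map fun p => p.reflect.switch) ∨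
        VirtualMove (w'.map fun p => p.reflect.switch) (w.map fun p => p.reflect.switch) := by
      cases h with
      | V1_right d =>
        left
        simpa [Piece.reflect, Piece.switch, Event.reflect, Event.switch]
          using VirtualMove.V1_left d
      | V1_left d =>
        left
        simpa [Piece.reflect, Piece.switch, Event.reflect, Event.switch]
          using VirtualMove.V1_right d
      | V2 p q =>
        left
        simpa [Piece.reflect, Piece.switch, Event.reflect, Event.switch]
          using VirtualMove.V2 q p
      | V3 p q r =>
        right
        simpa [Piece.reflect, Piece.switch, Event.reflect, Event.switch]
          using VirtualMove.V3 r q p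
      | V4_left s p q r =>
        right
        simpa [Piece.reflect, Piece.switch, Event.reflect, Event.switch]
          using VirtualMove.V4_right s r q p
      | V4_right s p q r =>
        right
        simpa [Piece.reflect, Piece.switch, Event.reflect, Event.switch]
          using VirtualMove.V4_left s r q p
    exact key.imp Or.inr Or.inr

theorem VirtualStep.reflect_switch {D D' : VirtualDiagram} (h : VirtualStep D D') :
    VirtualStep D.s D'.s ∨ VirtualStep D'.s D.s := by
  obtain ⟨b, a, l, r, w, w', hM, h1, h2⟩ := h
  have e : ∀ (u x : List Piece), u = b ++ x.map (Piece.pad l r) ++ a →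
      (u.map fun p => p.reflect.switch) = (b.map fun p => p.reflect.switch) ++
        (x.map fun p => p.reflect.switch).map (Piece.pad r.reverse l.reverse) ++
        (a.map fun p => p.reflect.switch) := by
    rintro u x rfl
    simp [Piece.pad_reflect_switch, Function.comp_def]
  rcases move_reflect_switch hM with hM | hM
  · exact Or.inl ⟨_, _, _, _, _, _, hM, e _ _ h1, e _ _ h2⟩
  · exact Or.inr ⟨_, _, _, _, _, _, hM, e _ _ h2, e _ _ h1⟩

/-- `s(L)`: the virtual link represented by `s(D)` for any diagram `D` of `L`. -/
def VirtualLink.s : VirtualLink → VirtualLink :=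
  Quot.lift (fun D => Quot.mk VirtualStep D.s) fun _ _ h =>
    h.reflect_switch.elim (fun h => Quot.sound h) (fun h => (Quot.sound h).symm)

end TwistedLinks

/-! Turning a crossing over means placing it, with its strands exchanged, between two virtual
crossings; `turnWord` does this everywhere. In the twisted world a row of bars on all strands can be
pushed through any bar-free piece at the cost of turning its crossing over (`bars_turnWord`). In a
closed diagram the row is empty at both ends, so a bar-free closed diagram is twisted equivalent to
its turned-over version. In the virtual world, conjugation by the virtual half twist changes the
turned-over diagram into the mirror image with switched crossings (`turnWord_halfTwist`). The half
twist of no strands is empty as well, so `turnWord D` represents s(D). This gives the "if"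
direction.

For the converse, bars have to be removed from the intermediate diagrams. A painting colours the
strands with two colours that change exactly at bars. Its image erases the bars, keeps the
`false`-`false` crossings, turns over the `true`-`true` crossings and makes the mixed ones virtual.
Every extended move carries paintings to paintings, and the images differ by bar-free moves
(`transports_of_move`). If all colours involved are `true`, this is because turning over respects
the moves (`Deform.turn_move`, again by the half twist); a strand of a different colour has only
virtual crossings and can be rerouted (`detour`). The all-`false` painting of a bar-free diagram has
that diagram as its image. Transported to a bar-free knot diagram it must be constant, so its image
there is the knot diagram or its turned-over version (`Painting.eq_of_isKnot`).

Since moves are local, the argument runs on tangle words with fixed boundaries; `Deform` is closed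
under stacking and padding. `VirtMove` asks for bar-free words on both sides, because the isotopies
include moves of bars. -/

namespace TwistedLinks

/-! ### Tangle words -/

/-- Adding vertical strands on both sides of a word. -/
def wpad (l r : List Dir) (w : List Piece) : List Piece := w.map (Piece.pad l r)

@[simp] theorem wpad_nil (l r : List Dir) : wpad l r [] = [] := rfl

@[simp] theorem wpad_cons (l r l' : List Dir) (e : Event) (r' : List Dir) (w : List Piece) :
    wpad l r (⟨l', e, r'⟩ :: w) = ⟨l ++ l', e, r' ++ r⟩ :: wpad l r w := rfl

@[simp] theorem wpad_append (l r : List Dir) (u v : List Piece) :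
    wpad l r (u ++ v) = wpad l r u ++ wpad l r v := List.map_append

@[simp] theorem wpad_wpad (l r l' r' : List Dir) (w : List Piece) :
    wpad l r (wpad l' r' w) = wpad (l ++ l') (r' ++ r) w := by
  simp [wpad, Piece.pad, Function.comp_def]

@[simp] theorem wpad_empty (w : List Piece) : wpad [] [] w = w := by
  have h : Piece.pad [] [] = id := by ext1 p; simp [Piece.pad]
  simp [wpad, h]

@[simp] theorem fits_nil {s t : List Dir} : Fits s [] t ↔ s = t := Iff.rfl

@[simp] theorem fits_cons {s t l r : List Dir} {e : Event} {w : List Piece} :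
    Fits s (⟨l, e, r⟩ :: w) t ↔ l ++ e.bot ++ r = s ∧ Fits (l ++ e.top ++ r) w t := Iff.rfl

theorem fits_append {s t : List Dir} {u v : List Piece} :
    Fits s (u ++ v) t ↔ ∃ m, Fits s u m ∧ Fits m v t := by
  induction u generalizing s with
  | nil => simp
  | cons p u ih =>
    rcases p with ⟨l, e, r⟩
    simp [ih, and_assoc]

theorem Fits.append {s m t : List Dir} {u v : List Piece} (hu : Fits s u m) (hv : Fits m v t) :
    Fits s (u ++ v) t := fits_append.2 ⟨m, hu, hv⟩

theorem Fits.wpad {s t : List Dir} {w : List Piece} (h : Fits s w t) (l r : List Dir) :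
    Fits (l ++ s ++ r) (wpad l r w) (l ++ t ++ r) := by
  induction w generalizing s with
  | nil => simp_all
  | cons p w ih =>
    rcases p with ⟨l', e, r'⟩
    obtain ⟨rfl, h⟩ := h
    refine ⟨by simp [Piece.bot, Piece.pad], ?_⟩
    simpa [Piece.top, Piece.pad, TwistedLinks.wpad] using ih h

theorem Fits.unique {s t t' : List Dir} {w : List Piece} (h : Fits s w t) (h' : Fits s w t') :
    t = t' := by
  induction w generalizing s with
  | nil => exact h.symm.trans h'
  | cons p w ih => exact ih h.2 h'.2

/-- Words without bars. -/
def NoBar (w : List Piece) : Prop := ∀ p ∈ w, ∀ d, p.event ≠ .bar d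

@[simp] theorem noBar_nil : NoBar [] := by simp [NoBar]

@[simp] theorem noBar_cons {p : Piece} {w : List Piece} :
    NoBar (p :: w) ↔ (∀ d, p.event ≠ .bar d) ∧ NoBar w := by simp [NoBar]

@[simp] theorem noBar_append {u v : List Piece} : NoBar (u ++ v) ↔ NoBar u ∧ NoBar v := by
  simp [NoBar, or_imp, forall_and]

@[simp] theorem noBar_wpad {l r : List Dir} {w : List Piece} : NoBar (wpad l r w) ↔ NoBar w := by
  simp [NoBar, wpad, Piece.pad]

/-! ### Deformations of tangles -/

/-- The equivalence relation on tangle words with lower boundary `s` and upper boundary `t` that is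
generated by the moves `M`. -/
inductive Deform (M : List Piece → List Piece → Prop) :
    List Dir → List Dir → List Piece → List Piece → Prop
  | refl {s t u} (h : Fits s u t) : Deform M s t u u
  | move {s t u v} (h : M u v) (hu : Fits s u t) (hv : Fits s v t) : Deform M s t u v
  | symm {s t u v} (h : Deform M s t u v) : Deform M s t v u
  | trans {s t u v w} (h : Deform M s t u v) (h' : Deform M s t v w) : Deform M s t u w
  | comp {s m t u v u' v'} (h : Deform M s m u v) (h' : Deform M m t u' v') :
      Deform M s t (u ++ u') (v ++ v')
  | pad {s t u v} (l r) (h : Deform M s t u v) :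
      Deform M (l ++ s ++ r) (l ++ t ++ r) (wpad l r u) (wpad l r v)

namespace Deform

variable {M : List Piece → List Piece → Prop} {s t m S T : List Dir} {u v w : List Piece}

theorem fits (h : Deform M s t u v) : Fits s u t ∧ Fits s v t := by
  induction h with
  | refl h => exact ⟨h, h⟩
  | move _ hu hv => exact ⟨hu, hv⟩
  | symm _ ih => exact ih.symm
  | trans _ _ ih ih' => exact ⟨ih.1, ih'.2⟩
  | comp _ _ ih ih' => exact ⟨ih.1.append ih'.1, ih.2.append ih'.2⟩
  | pad l r _ ih => exact ⟨ih.1.wpad l r, ih.2.wpad l r⟩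

theorem mono {M' : List Piece → List Piece → Prop} (hM : ∀ u v, M u v → M' u v)
    (h : Deform M s t u v) : Deform M' s t u v := by
  induction h with
  | refl h => exact .refl h
  | move h hu hv => exact .move (hM _ _ h) hu hv
  | symm _ ih => exact ih.symm
  | trans _ _ ih ih' => exact ih.trans ih'
  | comp _ _ ih ih' => exact ih.comp ih'
  | pad l r _ ih => exact ih.pad l r

theorem before (h : Deform M m t u v) (hw : Fits s w m) : Deform M s t (w ++ u) (w ++ v) :=
  (Deform.refl hw).comp h

theorem after (h : Deform M s m u v) (hw : Fits m w t) : Deform M s t (u ++ w) (v ++ w) :=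
  h.comp (.refl hw)

/-- A deformation inside a larger word. -/
theorem inside (h : Deform M s t u v) (below above : List Piece) (l r : List Dir)
    (hb : Fits S below (l ++ s ++ r)) (ha : Fits (l ++ t ++ r) above T) :
    Deform M S T (below ++ wpad l r u ++ above) (below ++ wpad l r v ++ above) :=
  ((h.pad l r).before hb).after ha

/-- A right factor with a right inverse can be cancelled. -/
theorem cancel_right {i : List Piece} (hi : Deform M t t (w ++ i) []) {x : List Dir}
    (hw : Fits t w x) (hu : Fits s u t) (hv : Fits s v t)
    (h : Deform M s x (u ++ w) (v ++ w)) : Deform M s t u v := by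
  obtain ⟨x', hx, hi'⟩ := fits_append.1 hi.fits.1
  obtain rfl := hx.unique hw
  have h1 : Deform M s t (u ++ (w ++ i)) u := by simpa using hi.before hu
  have h2 : Deform M s t (v ++ (w ++ i)) v := by simpa using hi.before hv
  have h3 : Deform M s t (u ++ (w ++ i)) (v ++ (w ++ i)) := by simpa using h.after hi'
  exact h1.symm.trans (h3.trans h2)

/-- The piece climbs past one event of `v` at a time; the strands `r ++ l'` between the two events
form the middle list of the exchange move. -/
theorem exchange_piece {p : Piece} {s' t' : List Dir}
    (hM : ∀ q ∈ v, ∀ m, M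
      [⟨[], p.event, m ++ q.event.bot⟩, ⟨p.event.top ++ m, q.event, []⟩]
      [⟨p.event.bot ++ m, q.event, []⟩, ⟨[], p.event, m ++ q.event.top⟩])
    (hv : Fits s' v t') :
    Deform M (p.bot ++ s') (p.top ++ t') (wpad [] s' [p] ++ wpad p.top [] v)
      (wpad p.bot [] v ++ wpad [] t' [p]) := by
  rcases p with ⟨l, e, r⟩
  induction v generalizing s' with
  | nil =>
    obtain rfl : s' = t' := hv
    exact .refl (by simp [Piece.bot, Piece.top])
  | cons q v ih =>
    rcases q with ⟨l', f, r'⟩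
    obtain ⟨rfl, hv⟩ := hv
    have h := (Deform.move (hM ⟨l', f, r'⟩ (by simp) (r ++ l'))
      (s := e.bot ++ (r ++ l') ++ f.bot) (t := e.top ++ (r ++ l') ++ f.top)
      (by simp) (by simp)).inside [] (wpad (l ++ e.top ++ r) [] v) l r'
      (S := l ++ e.bot ++ r ++ (l' ++ f.bot ++ r')) (T := l ++ e.top ++ r ++ t')
      (by simp) (by simpa [Piece.top] using hv.wpad (l ++ e.top ++ r) [])
    have h' := (ih hv (fun q hq => hM q (by simp [hq]))).before (s := l ++ e.bot ++ r ++
      (l' ++ f.bot ++ r')) (w := [⟨l ++ e.bot ++ r ++ l', f, r'⟩])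
      (by simp [Piece.bot, Piece.top])
    simp only [Piece.bot, Piece.top] at h' ⊢
    refine Deform.trans ?_ (u := _) (v := [⟨l ++ e.bot ++ r ++ l', f, r'⟩] ++
      (wpad [] (l' ++ f.top ++ r') [⟨l, e, r⟩] ++ wpad (l ++ e.top ++ r) [] v)) ?_
    · simpa using h
    · simpa using h'

/-- Tangles side by side exchange their heights. -/
theorem exchange {s' t' : List Dir}
    (hM : ∀ p ∈ u, ∀ q ∈ v, ∀ m, M
      [⟨[], p.event, m ++ q.event.bot⟩, ⟨p.event.top ++ m, q.event, []⟩]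
      [⟨p.event.bot ++ m, q.event, []⟩, ⟨[], p.event, m ++ q.event.top⟩])
    (hu : Fits s u t) (hv : Fits s' v t') :
    Deform M (s ++ s') (t ++ t') (wpad [] s' u ++ wpad t [] v) (wpad s [] v ++ wpad [] t' u) := by
  induction u generalizing s with
  | nil =>
    obtain rfl : s = t := hu
    simpa using Deform.refl (by simpa using hv.wpad s [])
  | cons p u ih =>
    obtain ⟨rfl, hu⟩ := hu
    have h1 := (ih (fun p hp => hM p (by simp [hp])) hu).before (s := p.bot ++ s')
      (w := wpad [] s' [p]) (by simp [wpad, Fits, Piece.pad, Piece.bot, Piece.top])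
    have h2 := (exchange_piece (hM p (by simp)) hv).after (w := wpad [] t' u)
      (by simpa using hu.wpad [] t')
    have e : ∀ x, wpad [] x (p :: u) = wpad [] x [p] ++ wpad [] x u := fun x => rfl
    rw [e, e]
    simp only [List.append_assoc] at h1 h2 ⊢
    exact h1.trans h2

end Deform

/-! ### Deformations through bar-free words -/

/-- The moves of bar-free words. -/
def VirtMove (u v : List Piece) : Prop :=
  (Isotopy ⊔ ClassicalMove ⊔ VirtualMove) u v ∧ NoBar u ∧ NoBar v

namespace Deform

variable {s t : List Dir} {u v : List Piece}

theorem isotopy (h : Isotopy u v) (hu : Fits s u t) (hv : Fits s v t) (nu : NoBar u)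
    (nv : NoBar v) : Deform VirtMove s t u v := .move ⟨Or.inl (Or.inl h), nu, nv⟩ hu hv

theorem classical (h : ClassicalMove u v) (hu : Fits s u t) (hv : Fits s v t) (nu : NoBar u)
    (nv : NoBar v) : Deform VirtMove s t u v := .move ⟨Or.inl (Or.inr h), nu, nv⟩ hu hv

theorem virtual (h : VirtualMove u v) (hu : Fits s u t) (hv : Fits s v t) (nu : NoBar u)
    (nv : NoBar v) : Deform VirtMove s t u v := .move ⟨Or.inr h, nu, nv⟩ hu hv

theorem exchange_virt {s' t' : List Dir} (nu : NoBar u) (nv : NoBar v)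
    (hu : Fits s u t) (hv : Fits s' v t') :
    Deform VirtMove (s ++ s') (t ++ t') (wpad [] s' u ++ wpad t [] v)
      (wpad s [] v ++ wpad [] t' u) :=
  exchange (fun p hp q hq m => ⟨Or.inl (Or.inl (.exchange _ _ _)),
    by simpa using ⟨nu p hp, nv q hq⟩, by simpa using ⟨nv q hq, nu p hp⟩⟩) hu hv

theorem virt_virt (p q : Dir) :
    Deform VirtMove [p, q] [p, q] [⟨[], .virt p q, []⟩, ⟨[], .virt q p, []⟩] [] :=
  virtual (.V2 p q) (by simp [Event.bot, Event.top]) (by simp) (by simp) (by simp)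

end Deform

/-! ### A virtual strand crossing a bundle of strands -/

/-- The strand `a` runs from the left of the strands `m` to their right, by virtual crossings. -/
def slide (a : Dir) : List Dir → List Piece
  | [] => []
  | b :: m => ⟨[], .virt a b, m⟩ :: wpad [b] [] (slide a m)

/-- The strand `a` runs from the right of the strands `m` to their left, by virtual crossings. -/
def slideBack (a : Dir) : List Dir → List Piece
  | [] => []
  | b :: m => wpad [b] [] (slideBack a m) ++ [⟨[], .virt b a, m⟩]

theorem slide_append (a : Dir) (m n : List Dir) :
    slide a (m ++ n) = wpad [] n (slide a m) ++ wpad m [] (slide a n) := by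
  induction m with
  | nil => simp [slide]
  | cons b m ih => simp [slide, ih]

theorem slideBack_append (a : Dir) (m n : List Dir) :
    slideBack a (m ++ n) = wpad m [] (slideBack a n) ++ wpad [] n (slideBack a m) := by
  induction m with
  | nil => simp [slideBack]
  | cons b m ih => simp [slideBack, ih]

theorem noBar_slide (a : Dir) (m : List Dir) : NoBar (slide a m) := by
  induction m <;> simp_all [slide]

theorem noBar_slideBack (a : Dir) (m : List Dir) : NoBar (slideBack a m) := by
  induction m <;> simp_all [slideBack]

theorem fits_slide (a : Dir) (m : List Dir) : Fits (a :: m) (slide a m) (m ++ [a]) := by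
  induction m with
  | nil => simp [slide]
  | cons b m ih => simpa [slide, Event.bot, Event.top] using ih.wpad [b] []

theorem fits_slideBack (a : Dir) (m : List Dir) : Fits (m ++ [a]) (slideBack a m) (a :: m) := by
  induction m with
  | nil => simp [slideBack]
  | cons b m ih =>
    refine Fits.append (by simpa using ih.wpad [b] []) ?_
    simp [Event.bot, Event.top]

theorem slide_slideBack (a : Dir) (m : List Dir) :
    Deform VirtMove (a :: m) (a :: m) (slide a m ++ slideBack a m) [] := by
  induction m with
  | nil => exact .refl (by simp [slide, slideBack])
  | cons b m ih =>
    have h1 := ih.inside [⟨[], .virt a b, m⟩] [⟨[], .virt b a, m⟩] [b] []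
      (S := a :: b :: m) (T := a :: b :: m) (by simp [Event.bot, Event.top])
      (by simp [Event.bot, Event.top])
    have h2 := (Deform.virt_virt a b).pad [] m
    simpa [slide, slideBack] using h1.trans (by simpa using h2)

theorem slideBack_slide (a : Dir) (m : List Dir) :
    Deform VirtMove (m ++ [a]) (m ++ [a]) (slideBack a m ++ slide a m) [] := by
  induction m with
  | nil => exact .refl (by simp [slide, slideBack])
  | cons b m ih =>
    have h1 := (Deform.virt_virt b a).inside (wpad [b] [] (slideBack a m))
      (wpad [b] [] (slide a m)) [] m
      (by simpa using (fits_slideBack a m).wpad [b] [])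
      (by simpa using (fits_slide a m).wpad [b] [])
    have h2 := ih.pad [b] []
    simpa [slide, slideBack] using h1.trans (by simpa using h2)

/-- At crossings this is V4 or V3. At an extremum the strand crosses both legs; sliding the extremum
through it trades the crossing with one leg for a crossing with the other, which forms a V2 pair.
Passing a bar would need T1, hence the exclusion. -/
theorem detour_event (a : Dir) (e : Event) (he : ∀ d, e ≠ .bar d) :
    Deform VirtMove (a :: e.bot) (e.top ++ [a]) (slide a e.bot ++ [⟨[], e, [a]⟩])
      (⟨[a], e, []⟩ :: slide a e.top) := by
  cases e with
  | max d =>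
    have h1 := (Deform.isotopy (s := [d, a, d.flip]) (t := [a]) (.max_virt d a)
      (by simp [Event.bot, Event.top]) (by simp [Event.bot, Event.top]) (by simp)
      (by simp)).before (s := [a, d, d.flip]) (w := [⟨[], .virt a d, [d.flip]⟩])
        (by simp [Event.bot, Event.top])
    have h2 := (Deform.virt_virt a d).inside [] [⟨[a], .max d, []⟩] [] [d.flip]
      (S := [a, d, d.flip]) (T := [a])
      (by simp) (by simp [Event.bot, Event.top])
    simpa [slide, Event.bot, Event.top] using h1.trans (by simpa using h2)
  | min d =>
    have h1 := (Deform.isotopy (s := [a]) (t := [d, a, d.flip]) (.min_virt d a)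
      (by simp [Event.bot, Event.top]) (by simp [Event.bot, Event.top]) (by simp)
      (by simp)).after (t := [d, d.flip, a]) (w := [⟨[d], .virt a d.flip, []⟩])
        (by simp [Event.bot, Event.top])
    have h2 := (Deform.virt_virt d.flip a).inside [⟨[], .min d, [a]⟩] [] [d] []
      (S := [a]) (T := [d, d.flip, a]) (by simp [Event.bot, Event.top]) (by simp)
    simpa [slide, Event.bot, Event.top] using (h1.symm.trans (by simpa using h2)).symm
  | cross s p q =>
    exact .virtual (.V4_right s a p q) (by simp [slide, Event.bot, Event.top])
      (by simp [slide, Event.bot, Event.top]) (by simp [noBar_slide]) (by simp [noBar_slide])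
  | virt p q =>
    exact .virtual (.V3 a p q) (by simp [slide, Event.bot, Event.top])
      (by simp [slide, Event.bot, Event.top]) (by simp [noBar_slide]) (by simp [noBar_slide])
  | bar d => exact absurd rfl (he d)

/-- The crossings of `a` with the bundles `l` and `r` lie beside the event and only exchange heights
with it; those with the legs of the event are handled by `detour_event`. -/
theorem detour_piece (a : Dir) (p : Piece) (hp : ∀ d, p.event ≠ .bar d) :
    Deform VirtMove (a :: p.bot) (p.top ++ [a]) (slide a p.bot ++ wpad [] [a] [p])
      (wpad [a] [] [p] ++ slide a p.top) := by
  rcases p with ⟨l, e, r⟩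
  have hl := (fits_slide a l).wpad [] (e.bot ++ r)
  have hr := (fits_slide a r).wpad (l ++ e.top) []
  have h1 := (Deform.exchange_virt (u := [⟨[], e, []⟩]) (s := e.bot) (t := e.top)
    (by simpa using hp) (noBar_slide a r) (by simp) (fits_slide a r)).inside
      (wpad [] (e.bot ++ r) (slide a l) ++ wpad l r (slide a e.bot)) [] l []
      (S := a :: l ++ e.bot ++ r)
      (Fits.append (by simpa using hl) (by simpa using (fits_slide a e.bot).wpad l r)) rfl
  have h2 := (detour_event a e hp).inside (wpad [] (e.bot ++ r) (slide a l))
    (wpad (l ++ e.top) [] (slide a r)) l r (by simpa using hl) (by simpa using hr)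
  have h3 := (Deform.exchange_virt (v := [⟨[], e, []⟩]) (s' := e.bot) (t' := e.top)
    (noBar_slide a l) (by simpa using hp) (fits_slide a l) (by simp)).inside
      [] (wpad l r (slide a e.top) ++ wpad (l ++ e.top) [] (slide a r)) [] r
      (S := a :: l ++ e.bot ++ r)
      (T := l ++ e.top ++ r ++ [a])
      (by simp) (Fits.append (by simpa using (fits_slide a e.top).wpad l r) (by simpa using hr))
  simp only [Piece.bot, Piece.top, slide_append]
  refine .trans (by simpa using h1.symm) (.trans (by simpa using h2) ?_)
  simpa using h3

/-- A virtual strand passes across a tangle. -/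
theorem detour (a : Dir) {s t : List Dir} {w : List Piece} (hw : Fits s w t) (hn : NoBar w) :
    Deform VirtMove (a :: s) (t ++ [a]) (slide a s ++ wpad [] [a] w)
      (wpad [a] [] w ++ slide a t) := by
  induction w generalizing s with
  | nil =>
    obtain rfl : s = t := hw
    simpa using Deform.refl (M := VirtMove) (fits_slide a s)
  | cons p w ih =>
    obtain ⟨rfl, hw⟩ := hw
    have hn := noBar_cons.1 hn
    have h1 := (detour_piece a p hn.1).after (w := wpad [] [a] w) (by simpa using hw.wpad [] [a])
    have h2 := (ih hw hn.2).before (s := a :: p.bot) (w := wpad [a] [] [p])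
      (by simp [wpad, Fits, Piece.pad, Piece.bot, Piece.top])
    have e : ∀ x y, wpad x y (p :: w) = wpad x y [p] ++ wpad x y w := fun x y => rfl
    rw [e, e]
    exact .trans (by simpa using h1) (by simpa using h2)

/-- Conjugate `detour` by `slideBack`, which inverts `slide` on both sides. -/
theorem detour_back (a : Dir) {s t : List Dir} {w : List Piece} (hw : Fits s w t)
    (hn : NoBar w) :
    Deform VirtMove (s ++ [a]) (a :: t) (slideBack a s ++ wpad [a] [] w)
      (wpad [] [a] w ++ slideBack a t) := by
  have hl : Fits (a :: s) (wpad [a] [] w) (a :: t) := by simpa using hw.wpad [a] []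
  have hr : Fits (s ++ [a]) (wpad [] [a] w) (t ++ [a]) := by simpa using hw.wpad [] [a]
  have h1 := (slide_slideBack a t).before ((fits_slideBack a s).append hl)
  have h2 := ((detour a hw hn).before (fits_slideBack a s)).after (fits_slideBack a t)
  have h3 := (slideBack_slide a s).after (hr.append (fits_slideBack a t))
  refine .trans (by simpa using h1.symm) (.trans (.symm ?_) (by simpa using h3))
  simpa using h2

/-! ### Virtual kinks at extremal points -/

/-- Insert a virtual kink (V1 after sliding a maximum through a crossing) on the right leg of the
plain minimum. The minimum and the crossing of the kink drop below the original minimum, which then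
cancels against the remaining maximum as a zigzag. -/
theorem min_virt_kink (d : Dir) :
    Deform VirtMove [] [d.flip, d] [⟨[], .min d, []⟩, ⟨[], .virt d d.flip, []⟩]
      [⟨[], .min d.flip, []⟩] := by
  have kink : Deform VirtMove [d] [d]
      [⟨[d], .min d, []⟩, ⟨[d], .virt d d.flip, []⟩, ⟨[], .max d, [d]⟩] [] := by
    have h1 := (Deform.isotopy (s := [d, d, d.flip]) (t := [d]) (.max_virt d d)
      (by simp [Event.bot, Event.top]) (by simp [Event.bot, Event.top]) (by simp)
      (by simp)).before (s := [d]) (w := [⟨[d], .min d, []⟩]) (by simp [Event.bot, Event.top])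
    exact h1.trans (.virtual (.V1_right d) (by simp [Event.bot, Event.top]) (by simp) (by simp)
      (by simp))
  have h1 := kink.inside [⟨[], .min d.flip, []⟩] [] [d.flip] [] (S := []) (T := [d.flip, d])
    (by simp [Event.bot, Event.top]) (by simp)
  have h2 := (Deform.exchange_virt (u := [⟨[], .min d.flip, []⟩])
    (v := [⟨[], .min d, []⟩, ⟨[], .virt d d.flip, []⟩]) (s := []) (s' := [])
    (t := [d.flip, d]) (t' := [d.flip, d]) (by simp) (by simp) (by simp [Event.bot, Event.top])
    (by simp [Event.bot, Event.top])).after (w := [⟨[d.flip], .max d, [d]⟩]) (t := [d.flip, d])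
    (by simp [Event.bot, Event.top])
  have h3 := (Deform.isotopy (s := [d.flip]) (t := [d.flip]) (.zigzag_right d.flip)
    (by simp [Event.bot, Event.top]) (by simp) (by simp) (by simp)).inside
    [⟨[], .min d, []⟩, ⟨[], .virt d d.flip, []⟩] [] [] [d] (S := []) (T := [d.flip, d])
    (by simp [Event.bot, Event.top]) (by simp)
  refine .symm (.trans (by simpa using h1.symm) (.trans (by simpa using h2) ?_))
  simpa using h3

/-- The argument of `min_virt_kink` upside down. -/
theorem max_virt_kink (d : Dir) :
    Deform VirtMove [d.flip, d] [] [⟨[], .virt d.flip d, []⟩, ⟨[], .max d, []⟩]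
      [⟨[], .max d.flip, []⟩] := by
  have kink : Deform VirtMove [d] [d]
      [⟨[], .min d, [d]⟩, ⟨[d], .virt d.flip d, []⟩, ⟨[d], .max d, []⟩] [] := by
    have h1 := (Deform.isotopy (s := [d]) (t := [d, d, d.flip]) (.min_virt d d)
      (by simp [Event.bot, Event.top]) (by simp [Event.bot, Event.top]) (by simp)
      (by simp)).after (t := [d]) (w := [⟨[d], .max d, []⟩]) (by simp [Event.bot, Event.top])
    exact h1.trans (.virtual (.V1_right d) (by simp [Event.bot, Event.top]) (by simp) (by simp)
      (by simp))
  have h1 := kink.inside [] [⟨[], .max d.flip, []⟩] [d.flip] [] (S := [d.flip, d]) (T := [])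
    (by simp) (by simp [Event.bot, Event.top])
  have h2 := (Deform.exchange_virt (u := [⟨[], .max d.flip, []⟩])
    (v := [⟨[], .virt d.flip d, []⟩, ⟨[], .max d, []⟩]) (s := [d.flip, d]) (s' := [d.flip, d])
    (t := []) (t' := []) (by simp) (by simp) (by simp [Event.bot, Event.top])
    (by simp [Event.bot, Event.top])).before (w := [⟨[d.flip], .min d, [d]⟩]) (s := [d.flip, d])
    (by simp [Event.bot, Event.top])
  have h3 := (Deform.isotopy (s := [d.flip]) (t := [d.flip]) (.zigzag_left d.flip)
    (by simp [Event.bot, Event.top]) (by simp) (by simp) (by simp)).inside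
    [] [⟨[], .virt d.flip d, []⟩, ⟨[], .max d, []⟩] [] [d] (S := [d.flip, d]) (T := [])
    (by simp) (by simp [Event.bot, Event.top])
  refine .symm (.trans (by simpa using h1.symm) (.trans (by simpa using h2.symm) ?_))
  simpa using h3

/-! ### The virtual half twist -/

/-- The virtual half twist, which reverses the order of the strands. -/
def halfTwist : List Dir → List Piece
  | [] => []
  | a :: s => wpad [a] [] (halfTwist s) ++ slide a s.reverse

theorem fits_halfTwist (s : List Dir) : Fits s (halfTwist s) s.reverse := by
  induction s with
  | nil => simp [halfTwist]
  | cons a s ih =>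
    exact Fits.append (by simpa using ih.wpad [a] []) (by simpa using fits_slide a s.reverse)

/-- A one-sided inverse suffices: it serves to cancel the half twist at the top in
`Deform.turn_move`. -/
theorem halfTwist_cancel (s : List Dir) :
    ∃ i, Deform VirtMove s s (halfTwist s ++ i) [] := by
  induction s with
  | nil => exact ⟨[], .refl (by simp [halfTwist])⟩
  | cons a s ih =>
    obtain ⟨i, hi⟩ := ih
    refine ⟨slideBack a s.reverse ++ wpad [a] [] i, ?_⟩
    obtain ⟨m, h, h'⟩ := fits_append.1 hi.fits.1
    obtain rfl := h.unique (fits_halfTwist s)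
    have h1 := ((slide_slideBack a s.reverse).before (w := wpad [a] [] (halfTwist s)) (s := a :: s)
      (by simpa using h.wpad [a] [])).after (w := wpad [a] [] i) (t := a :: s)
      (by simpa using h'.wpad [a] [])
    refine .trans (by simpa [halfTwist] using h1) ?_
    simpa using hi.pad [a] []

/-- `halfTwist` recurses on the first strand; this is the recursion on the last one. They agree
because the first strand detours past all crossings of `b`. -/
theorem halfTwist_concat (s : List Dir) (b : Dir) :
    Deform VirtMove (s ++ [b]) (b :: s.reverse) (halfTwist (s ++ [b]))
      (wpad [] [b] (halfTwist s) ++ slideBack b s.reverse) := by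
  induction s with
  | nil => exact .refl (by simp [halfTwist, slide])
  | cons a s ih =>
    have h1 := (ih.pad [a] []).after (w := slide a (b :: s.reverse)) (t := b :: s.reverse ++ [a])
      (by simpa using fits_slide a (b :: s.reverse))
    have h2 := (detour a (fits_slideBack b s.reverse) (noBar_slideBack b s.reverse)).before
      (s := a :: s ++ [b]) (w := wpad [a] [b] (halfTwist s))
      (by simpa using (fits_halfTwist s).wpad [a] [b])
    refine .trans (by simpa [halfTwist] using h1) (.symm ?_)
    simpa [halfTwist, slideBack_append, slide_append, slide, slideBack] using h2

/-! ### Turning over -/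

/-- A crossing turned over, that is, the crossing between two virtual crossings. -/
def Event.turn : Event → List Piece
  | cross s p q => [⟨[], .virt p q, []⟩, ⟨[], .cross s q p, []⟩, ⟨[], .virt p q, []⟩]
  | bar _ => []
  | e => [⟨[], e, []⟩]

def Piece.turn (p : Piece) : List Piece := wpad p.lft p.rgt p.event.turn

/-- All crossings turned over and all bars erased. -/
def turnWord (w : List Piece) : List Piece := w.flatMap Piece.turn

/-- The mirror image with switched crossings. -/
def mirror (w : List Piece) : List Piece := w.map fun p => p.reflect.switch

theorem Event.fits_turn (e : Event) : Fits e.bot e.turn e.top := by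
  cases e <;> simp [Event.turn, Event.bot, Event.top]

theorem Piece.fits_turn (p : Piece) : Fits p.bot p.turn p.top :=
  p.event.fits_turn.wpad p.lft p.rgt

theorem Fits.turnWord {s t : List Dir} {w : List Piece} (h : Fits s w t) :
    Fits s (turnWord w) t := by
  induction w generalizing s with
  | nil => exact h
  | cons p w ih =>
    obtain ⟨rfl, h⟩ := h
    exact p.fits_turn.append (ih h)

/-- The upper virtual crossing of a turned-over crossing cancels against the half twist above it by
V2, leaving the lower one as the half twist below. Extrema are the virtual kinks, and for a virtual
crossing both words coincide. -/
theorem turn_halfTwist_event (e : Event) (he : ∀ d, e ≠ .bar d) :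
    Deform VirtMove e.bot e.top.reverse (e.turn ++ halfTwist e.top)
      (halfTwist e.bot ++ [⟨[], e.reflect.switch, []⟩]) := by
  cases e with
  | max d =>
    simpa [Event.turn, halfTwist, slide, Event.bot, Event.top, Event.reflect, Event.switch]
      using (max_virt_kink d.flip).symm
  | min d =>
    simpa [Event.turn, halfTwist, slide, Event.bot, Event.top, Event.reflect, Event.switch]
      using min_virt_kink d
  | cross s p q =>
    have h := (Deform.virt_virt p q).before (s := [p, q])
      (w := [⟨[], .virt p q, []⟩, ⟨[], .cross s q p, []⟩]) (by simp [Event.bot, Event.top])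
    simpa [Event.turn, halfTwist, slide, Event.bot, Event.top, Event.reflect, Event.switch] using h
  | virt p q =>
    exact .refl (by simp [Event.turn, halfTwist, slide, Event.bot, Event.top])
  | bar d => exact absurd rfl (he d)

/-- Vertical strands are added one by one: on the left by the definition of `halfTwist`, on the
right by `halfTwist_concat`. Each new strand detours past the mirrored event. -/
theorem turn_halfTwist_piece (p : Piece) (hp : ∀ d, p.event ≠ .bar d) :
    Deform VirtMove p.bot p.top.reverse (p.turn ++ halfTwist p.top)
      (halfTwist p.bot ++ [p.reflect.switch]) := by
  have hs : ∀ p : Piece, (∀ d, p.event ≠ .bar d) → NoBar [p.reflect.switch] := by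
    rintro ⟨l, e, r⟩ h
    cases e <;> simp_all [Piece.reflect, Piece.switch, Event.reflect, Event.switch]
  have hf : ∀ p : Piece, Fits p.bot.reverse [p.reflect.switch] p.top.reverse := fun p =>
    ⟨p.bot_reflect_switch, p.top_reflect_switch⟩
  rcases p with ⟨l, e, r⟩
  induction l with
  | nil =>
    induction r using List.reverseRecOn with
    | nil =>
      simpa [Piece.turn, Piece.bot, Piece.top, Piece.reflect, Piece.switch] using
        turn_halfTwist_event e hp
    | append_singleton r b ih =>
      have ih := ih hp
      have hp' := hs ⟨[], e, r⟩ hp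
      have hf' := hf ⟨[], e, r⟩
      have ht := Piece.fits_turn ⟨[], e, r⟩
      simp only [Piece.bot, Piece.top, List.nil_append, Piece.turn, Piece.reflect,
        Piece.switch, List.reverse_nil] at ih hp' hf' ht hp ⊢
      rw [← List.append_assoc, ← List.append_assoc]
      have h1 := (halfTwist_concat (e.top ++ r) b).before (s := e.bot ++ r ++ [b])
        (w := wpad [] (r ++ [b]) e.turn) (by simpa using ht.wpad [] [b])
      have h2 := (ih.pad [] [b]).after (fits_slideBack b _)
      have h3 := (detour_back b hf' hp').before (s := e.bot ++ r ++ [b])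
        (by simpa using (fits_halfTwist (e.bot ++ r)).wpad [] [b])
      have h4 := (halfTwist_concat (e.bot ++ r) b).after (t := b :: (e.top ++ r).reverse)
        (w := [⟨b :: r.reverse, e.reflect.switch, []⟩]) (by simpa using hf'.wpad [b] [])
      refine .trans (by simpa using h1) (.trans (by simpa using h2) (.trans ?_
        (by simpa using h4.symm)))
      simpa [Piece.pad] using h3.symm
  | cons a l ih =>
    have ih := ih hp
    have hp' := hs ⟨l, e, r⟩ hp
    have hf' := hf ⟨l, e, r⟩
    simp only [Piece.bot, Piece.top, Piece.turn, Piece.reflect,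
      Piece.switch] at ih hp' hf' hp ⊢
    have h1 := (ih.pad [a] []).after (fits_slide a _)
    have h2 := (detour a hf' hp').before (s := a :: (l ++ e.bot ++ r))
      (by simpa using (fits_halfTwist (l ++ e.bot ++ r)).wpad [a] [])
    refine .trans (by simpa [halfTwist] using h1) (.symm ?_)
    simpa [halfTwist] using h2

theorem turnWord_halfTwist {s t : List Dir} {w : List Piece} (h : Fits s w t) (hn : NoBar w) :
    Deform VirtMove s t.reverse (turnWord w ++ halfTwist t) (halfTwist s ++ mirror w) := by
  induction w generalizing s with
  | nil =>
    obtain rfl : s = t := h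
    simpa [turnWord, mirror] using Deform.refl (fits_halfTwist s)
  | cons p w ih =>
    obtain ⟨rfl, h⟩ := h
    have hn := noBar_cons.1 hn
    have h1 := (ih h hn.2).before p.fits_turn
    have h2 := (turn_halfTwist_piece p hn.1).after h.reflect_switch
    exact .trans (by simpa [turnWord] using h1) (by simpa [mirror] using h2)


/-! ### Paintings -/

/-- The bar-free image of a crossing of strands coloured `a` and `b`. -/
def crossImage (s : Bool) (p q : Dir) : Bool → Bool → List Piece
  | false, false => [⟨[], .cross s p q, []⟩]
  | true, true => (Event.cross s p q).turn
  | _, _ => [⟨[], .virt p q, []⟩]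

/-- `e.Paint c c' v`: colours `c` of the strands entering `e` and `c'` of those leaving it, such
that colours change exactly at bars; and the bar-free image `v` of `e`. -/
inductive Event.Paint : Event → List Bool → List Bool → List Piece → Prop
  | max (d : Dir) (a : Bool) : Paint (.max d) [a, a] [] [⟨[], .max d, []⟩]
  | min (d : Dir) (a : Bool) : Paint (.min d) [] [a, a] [⟨[], .min d, []⟩]
  | cross (s : Bool) (p q : Dir) (a b : Bool) :
      Paint (.cross s p q) [a, b] [b, a] (crossImage s p q a b)
  | virt (p q : Dir) (a b : Bool) : Paint (.virt p q) [a, b] [b, a] [⟨[], .virt p q, []⟩]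
  | bar (d : Dir) (a : Bool) : Paint (.bar d) [a] [!a] []

theorem fits_crossImage (s : Bool) (p q : Dir) (a b : Bool) :
    Fits [p, q] (crossImage s p q a b) [q, p] := by
  cases a <;> cases b <;> simp [crossImage, Event.turn, Event.bot, Event.top]

theorem noBar_crossImage (s : Bool) (p q : Dir) (a b : Bool) : NoBar (crossImage s p q a b) := by
  cases a <;> cases b <;> simp [crossImage, Event.turn]

namespace Event.Paint

variable {e : Event} {c c' : List Bool} {v : List Piece}

theorem length_bot (h : e.Paint c c' v) : c.length = e.bot.length := by
  cases h <;> rfl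

theorem length_top (h : e.Paint c c' v) : c'.length = e.top.length := by
  cases h <;> rfl

theorem fits (h : e.Paint c c' v) : Fits e.bot v e.top := by
  cases h with
  | cross s p q a b => exact fits_crossImage s p q a b
  | _ => simp [Event.bot, Event.top]

theorem noBar (h : e.Paint c c' v) : NoBar v := by
  cases h with
  | cross s p q a b => exact noBar_crossImage s p q a b
  | _ => simp

@[simp] theorem max_iff {d : Dir} : (Event.max d).Paint c c' v ↔
    ∃ a, c = [a, a] ∧ c' = [] ∧ v = [⟨[], .max d, []⟩] :=
  ⟨fun h => by cases h; simp, by rintro ⟨a, rfl, rfl, rfl⟩; constructor⟩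

@[simp] theorem min_iff {d : Dir} : (Event.min d).Paint c c' v ↔
    c = [] ∧ ∃ a, c' = [a, a] ∧ v = [⟨[], .min d, []⟩] :=
  ⟨fun h => by cases h; simp, by rintro ⟨rfl, a, rfl, rfl⟩; constructor⟩

@[simp] theorem cross_iff {s : Bool} {p q : Dir} : (Event.cross s p q).Paint c c' v ↔
    ∃ a b, c = [a, b] ∧ c' = [b, a] ∧ v = crossImage s p q a b :=
  ⟨fun h => by cases h; exact ⟨_, _, rfl, rfl, rfl⟩, by rintro ⟨a, b, rfl, rfl, rfl⟩; constructor⟩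

@[simp] theorem virt_iff {p q : Dir} : (Event.virt p q).Paint c c' v ↔
    ∃ a b, c = [a, b] ∧ c' = [b, a] ∧ v = [⟨[], .virt p q, []⟩] :=
  ⟨fun h => by cases h; exact ⟨_, _, rfl, rfl, rfl⟩, by rintro ⟨a, b, rfl, rfl, rfl⟩; constructor⟩

@[simp] theorem bar_iff {d : Dir} : (Event.bar d).Paint c c' v ↔
    ∃ a, c = [a] ∧ c' = [!a] ∧ v = [] :=
  ⟨fun h => by cases h; simp, by rintro ⟨a, rfl, rfl, rfl⟩; constructor⟩

end Event.Paint

/-- `Painting w c c' v`: a colouring of the strands of `w` which changes exactly at bars, with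
colours `c` on the lower and `c'` on the upper boundary; and the bar-free image `v` of `w`. -/
def Painting : List Piece → List Bool → List Bool → List Piece → Prop
  | [], c, c', v => v = [] ∧ c' = c
  | ⟨l, e, r⟩ :: w, c, c', v => ∃ cl ce ce' cr ve v', cl.length = l.length ∧
      cr.length = r.length ∧ e.Paint ce ce' ve ∧ c = cl ++ ce ++ cr ∧
      v = wpad l r ve ++ v' ∧ Painting w (cl ++ ce' ++ cr) c' v'

/-- Paintings of `w` correspond to paintings of `w'`, with equivalent images. -/
def Transports (w w' : List Piece) : Prop :=
  ∃ s t, Fits s w t ∧ Fits s w' t ∧ ∀ c c' v, c.length = s.length →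
    (Painting w c c' v → ∃ v', Painting w' c c' v' ∧ Deform VirtMove s t v v') ∧
    (Painting w' c c' v → ∃ v', Painting w c c' v' ∧ Deform VirtMove s t v v')

/-- Here `ι` records the independent colours, so that matching paintings share a parameter and only
their images need comparison. The length of `c` must be prescribed because the empty word can be
painted by a list of any length. -/
theorem Transports.of_param {w w' : List Piece} (s t : List Dir) {ι : Type*}
    (C C' : ι → List Bool) (F F' : ι → List Piece) (hs : Fits s w t) (hs' : Fits s w' t)
    (hw : ∀ c c' v, c.length = s.length →
      (Painting w c c' v ↔ ∃ i, c = C i ∧ v = F i ∧ c' = C' i))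
    (hw' : ∀ c c' v, c.length = s.length →
      (Painting w' c c' v ↔ ∃ i, c = C i ∧ v = F' i ∧ c' = C' i))
    (hd : ∀ i, Deform VirtMove s t (F i) (F' i)) : Transports w w' := by
  refine ⟨s, t, hs, hs', fun c c' v hc => ⟨fun h => ?_, fun h => ?_⟩⟩
  · obtain ⟨i, rfl, rfl, rfl⟩ := (hw _ _ _ hc).1 h
    exact ⟨F' i, (hw' _ _ _ hc).2 ⟨i, rfl, rfl, rfl⟩, hd i⟩
  · obtain ⟨i, rfl, rfl, rfl⟩ := (hw' _ _ _ hc).1 h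
    exact ⟨F i, (hw _ _ _ hc).2 ⟨i, rfl, rfl, rfl⟩, (hd i).symm⟩

/-- Mirroring with switched crossings maps moves to moves, possibly reversed. The half twist
intertwines the mirrored words with the turned-over ones, and is cancelled at the top. -/
theorem Deform.turn_move {s t : List Dir} {w w' : List Piece}
    (hM : (Isotopy ⊔ ClassicalMove ⊔ VirtualMove) w w') (hn : NoBar w) (hn' : NoBar w')
    (hw : Fits s w t) (hw' : Fits s w' t) :
    Deform VirtMove s t (turnWord w) (turnWord w') := by
  have noBar_mirror : ∀ w, NoBar w → NoBar (mirror w) := by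
    intro w h p hp d
    obtain ⟨⟨l, e, r⟩, hp', rfl⟩ := List.mem_map.1 hp
    have h := h _ hp'
    cases e <;> simp_all [Piece.reflect, Piece.switch, Event.reflect, Event.switch]
  have fits_mirror : ∀ w, Fits s w t → Fits s.reverse (mirror w) t.reverse :=
    fun w h => h.reflect_switch
  have key : Deform VirtMove s.reverse t.reverse (mirror w) (mirror w') := by
    rcases move_reflect_switch hM with h | h
    · exact .move ⟨h, noBar_mirror w hn, noBar_mirror w' hn'⟩ (fits_mirror w hw)
        (fits_mirror w' hw')
    · exact .symm (.move ⟨h, noBar_mirror w' hn', noBar_mirror w hn⟩ (fits_mirror w' hw')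
        (fits_mirror w hw))
  obtain ⟨i, hi⟩ := halfTwist_cancel t
  exact .cancel_right hi (fits_halfTwist t) hw.turnWord hw'.turnWord
    (((turnWord_halfTwist hw hn).trans (key.before (fits_halfTwist s))).trans
      (turnWord_halfTwist hw' hn').symm)


attribute [local simp] Event.bot Event.top in
-- This is R3 when the middle strand has the odd colour. A V2 pair of `q` and `r` inserted at the
-- bottom makes `q` cross both other strands below `k`; `detour_back` moves these crossings above
-- `k`, where another V2 pair cancels.
theorem Deform.strand_between {p q r : Dir} {k : List Piece} (hk : Fits [p, r] k [r, p])
    (hn : NoBar k) :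
    Deform VirtMove [p, q, r] [r, q, p]
      (⟨[], .virt p q, [r]⟩ :: wpad [q] [] k ++ [⟨[], .virt q r, [p]⟩])
      (⟨[p], .virt q r, []⟩ :: wpad [] [q] k ++ [⟨[r], .virt p q, []⟩]) := by
  have hl : Fits [q, p, r] (wpad [q] [] k) [q, r, p] := by simpa using hk.wpad [q] []
  have hr : Fits [p, r, q] (wpad [] [q] k) [r, p, q] := by simpa using hk.wpad [] [q]
  have h1 := (Deform.virt_virt q r).inside [] (⟨[], .virt p q, [r]⟩ :: wpad [q] [] k ++
    [⟨[], .virt q r, [p]⟩]) [p] [] (S := [p, q, r]) (T := [r, q, p]) (by simp)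
    (by simpa using hl.append (t := [r, q, p]) (v := [⟨[], .virt q r, [p]⟩]) (by simp))
  have h2 := (detour_back q hk hn).inside [⟨[p], .virt q r, []⟩] [⟨[], .virt q r, [p]⟩] [] []
    (S := [p, q, r]) (T := [r, q, p]) (by simp) (by simp)
  have h3 := (Deform.virt_virt r q).inside (⟨[p], .virt q r, []⟩ :: wpad [] [q] k ++
    [⟨[r], .virt p q, []⟩]) [] [] [p] (S := [p, q, r]) (T := [r, q, p])
    (by simpa using hr.append (t := [r, q, p]) (v := [⟨[r], .virt p q, []⟩]) (by simp)) (by simp)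
  refine .trans (by simpa using h1.symm) (.trans (by simpa [slideBack] using h2) ?_)
  simpa using h3

theorem painting_nil_one (c c' : List Bool) (v : List Piece) (hc : c.length = 1) :
    Painting [] c c' v ↔ ∃ a, c = [a] ∧ v = [] ∧ c' = [a] := by
  obtain ⟨a, rfl⟩ := List.length_eq_one_iff.1 hc
  exact ⟨fun h => ⟨a, rfl, h.1, h.2⟩, by rintro ⟨b, h, rfl, rfl⟩; exact ⟨rfl, h.symm⟩⟩

theorem painting_nil_two (c c' : List Bool) (v : List Piece) (hc : c.length = 2) :
    Painting [] c c' v ↔ ∃ a : Bool × Bool, c = [a.1, a.2] ∧ v = [] ∧ c' = [a.1, a.2] := by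
  obtain ⟨a, b, rfl⟩ := List.length_eq_two.1 hc
  exact ⟨fun h => ⟨(a, b), rfl, h.1, h.2⟩, by rintro ⟨b, h, rfl, rfl⟩; exact ⟨rfl, h.symm⟩⟩

/-! ### Transport of paintings, move by move -/

section Moves

attribute [local simp] Event.bot Event.top List.length_eq_zero_iff List.length_eq_one_iff

attribute [-simp] Bool.exists_bool

/-- Only V4 has images that depend on the colours. There the image of the classical crossing is
always a bar-free tangle, and a detour passes the virtual strand across it without a case
distinction. -/
theorem VirtualMove.transports {w w' : List Piece} (h : VirtualMove w w') : Transports w w' := by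
  have h0 := h
  cases h with
  | V1_right d =>
    exact .of_param [d] [d] (fun a : Bool => [a]) (fun a => [a]) (fun _ => _) (fun _ => [])
      (by simp) (by simp) (by simp [Painting]) painting_nil_one fun _ =>
      .virtual h0 (by simp) (by simp) (by simp) (by simp)
  | V1_left d =>
    exact .of_param [d] [d] (fun a : Bool => [a]) (fun a => [a]) (fun _ => _) (fun _ => [])
      (by simp) (by simp) (by simp [Painting]) painting_nil_one fun _ =>
      .virtual h0 (by simp) (by simp) (by simp) (by simp)
  | V2 p q =>
    exact .of_param [p, q] [p, q] (fun a : Bool × Bool => [a.1, a.2]) (fun a => [a.1, a.2])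
      (fun _ => _) (fun _ => []) (by simp) (by simp) (by simp [Painting]) painting_nil_two fun _ =>
      .virtual h0 (by simp) (by simp) (by simp) (by simp)
  | V3 p q r =>
    exact .of_param [p, q, r] [r, q, p] (fun a : Bool × Bool × Bool => [a.1, a.2.1, a.2.2])
      (fun a => [a.2.2, a.2.1, a.1])
      (fun _ => _) (fun _ => _) (by simp) (by simp) (by simp [Painting]) (by simp [Painting])
      fun _ => .virtual h0 (by simp) (by simp) (by simp) (by simp)
  | V4_left s p q r =>
    refine .of_param [p, q, r] [r, q, p] (fun a : Bool × Bool × Bool => [a.1, a.2.1, a.2.2])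
      (fun a => [a.2.2, a.2.1, a.1])
      (fun a => wpad [] [r] (crossImage s p q a.1 a.2.1) ++
        [⟨[q], .virt p r, []⟩, ⟨[], .virt q r, [p]⟩])
      (fun a => [⟨[p], .virt q r, []⟩, ⟨[], .virt p r, [q]⟩] ++
        wpad [r] [] (crossImage s p q a.1 a.2.1))
      (by simp) (by simp)
      (by
        simp [Painting]
        exact fun _ _ _ _ => ⟨fun ⟨_, _, _, h⟩ => ⟨_, _, _, h⟩, fun ⟨_, _, _, h⟩ => ⟨_, _, _, h⟩⟩)
      (by simp [Painting]) fun a => ?_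
    simpa [slideBack] using
      (detour_back r (fits_crossImage s p q a.1 a.2.1) (noBar_crossImage _ _ _ _ _)).symm
  | V4_right s p q r =>
    refine .of_param [p, q, r] [r, q, p] (fun a : Bool × Bool × Bool => [a.1, a.2.1, a.2.2])
      (fun a => [a.2.2, a.2.1, a.1])
      (fun a => [⟨[], .virt p q, [r]⟩, ⟨[q], .virt p r, []⟩] ++
        wpad [] [p] (crossImage s q r a.2.1 a.2.2))
      (fun a => wpad [p] [] (crossImage s q r a.2.1 a.2.2) ++
        [⟨[], .virt p r, [q]⟩, ⟨[r], .virt p q, []⟩])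
      (by simp) (by simp) (by simp [Painting]) (by simp [Painting]) fun a => ?_
    simpa [slide] using detour p (fits_crossImage s q r a.2.1 a.2.2) (noBar_crossImage _ _ _ _ _)

/-- If all strands are `false`, the image is the move itself; if all are `true`, it is the
turned-over move. With mixed colours R2 becomes V2, and in R3 the strand of the odd colour is
virtual and makes a detour. -/
theorem ClassicalMove.transports {w w' : List Piece} (h : ClassicalMove w w') :
    Transports w w' := by
  have h0 := h
  have hM : (Isotopy ⊔ ClassicalMove ⊔ VirtualMove) w w' := Or.inl (Or.inr h)
  cases h with
  | R1_right s d =>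
    refine .of_param [d] [d] (fun a : Bool => [a]) (fun a => [a])
      (fun a => [⟨[d], .min d, []⟩] ++ wpad [] [d.flip] (crossImage s d d a a) ++
        [⟨[d], .max d, []⟩]) (fun _ => [])
      (by simp) (by simp) (by simp [Painting]) painting_nil_one fun a => ?_
    cases a
    · exact .classical h0 (by simp [crossImage]) (by simp) (by simp [crossImage]) (by simp)
    · simpa [turnWord, Piece.turn, Event.turn, crossImage] using
        Deform.turn_move (s := [d]) (t := [d]) hM (by simp) (by simp) (by simp) (by simp)
  | R1_left s d =>
    refine .of_param [d] [d] (fun a : Bool => [a]) (fun a => [a])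
      (fun a => [⟨[], .min d.flip, [d]⟩] ++ wpad [d.flip] [] (crossImage s d d a a) ++
        [⟨[], .max d.flip, [d]⟩]) (fun _ => [])
      (by simp) (by simp) (by simp [Painting]) painting_nil_one fun a => ?_
    cases a
    · exact .classical h0 (by simp [crossImage]) (by simp) (by simp [crossImage]) (by simp)
    · simpa [turnWord, Piece.turn, Event.turn, crossImage] using
        Deform.turn_move (s := [d]) (t := [d]) hM (by simp) (by simp) (by simp) (by simp)
  | R2 s p q =>
    refine .of_param [p, q] [p, q] (fun a : Bool × Bool => [a.1, a.2]) (fun a => [a.1, a.2])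
      (fun a => crossImage s p q a.1 a.2 ++ crossImage (!s) q p a.2 a.1) (fun _ => [])
      (by simp) (by simp) (by simp [Painting]) painting_nil_two fun a => ?_
    obtain ⟨_ | _, _ | _⟩ := a
    · exact .classical h0 (by simp [crossImage]) (by simp) (by simp [crossImage]) (by simp)
    · exact .virt_virt p q
    · exact .virt_virt p q
    · simpa [turnWord, Piece.turn, Event.turn, crossImage] using
        Deform.turn_move (s := [p, q]) (t := [p, q]) hM (by simp) (by simp) (by simp) (by simp)
  | R3 a b c habc p q r =>
    refine .of_param [p, q, r] [r, q, p] (fun a : Bool × Bool × Bool => [a.1, a.2.1, a.2.2])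
      (fun a => [a.2.2, a.2.1, a.1])
      (fun x => wpad [] [r] (crossImage a p q x.1 x.2.1) ++
        wpad [q] [] (crossImage b p r x.1 x.2.2) ++ wpad [] [p] (crossImage c q r x.2.1 x.2.2))
      (fun x => wpad [p] [] (crossImage c q r x.2.1 x.2.2) ++
        wpad [] [q] (crossImage b p r x.1 x.2.2) ++ wpad [r] [] (crossImage a p q x.1 x.2.1))
      (by simp) (by simp)
      (by
        simp [Painting]
        exact fun _ _ _ _ => ⟨fun ⟨_, _, _, h⟩ => ⟨_, _, _, h⟩, fun ⟨_, _, _, h⟩ => ⟨_, _, _, h⟩⟩)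
      (by simp [Painting]) fun x => ?_
    -- `first`, `middle` and `last` refer to the crossing of the left word whose strands have equal
    -- colours; the odd strand is `r`, `q` and `p` respectively.
    have first (x : Bool) := (detour_back r (fits_crossImage a p q x x)
      (noBar_crossImage _ _ _ _ _)).symm
    have last (x : Bool) := detour p (fits_crossImage c q r x x) (noBar_crossImage _ _ _ _ _)
    have middle (x : Bool) := Deform.strand_between (q := q) (fits_crossImage b p r x x)
      (noBar_crossImage _ _ _ _ _)
    obtain ⟨_ | _, _ | _, _ | _⟩ := x
    · exact .classical h0 (by simp [crossImage]) (by simp [crossImage])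
        (by simp [crossImage]) (by simp [crossImage])
    · simpa [crossImage, slideBack] using first false
    · simpa [crossImage] using middle false
    · simpa [crossImage, slide] using last true
    · simpa [crossImage, slide] using last false
    · simpa [crossImage] using middle true
    · simpa [crossImage, slideBack] using first true
    · simpa [turnWord, Piece.turn, Event.turn, crossImage] using
        Deform.turn_move (s := [p, q, r]) (t := [r, q, p]) hM (by simp) (by simp) (by simp)
          (by simp)

/-- In T1 and T2 bars only change colours, so both images agree. T3 dictates the image of a
`true`-`true` crossing: the bars flip both colours, which has to amount to turning the crossing
over. -/
theorem TwistedMove.transports {w w' : List Piece} (h : TwistedMove w w') : Transports w w' := by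
  cases h with
  | T1_left p q =>
    exact .of_param [p, q] [q, p] (fun a : Bool × Bool => [a.1, a.2]) (fun a => [a.2, !a.1])
      (fun _ => [⟨[], .virt p q, []⟩]) (fun _ => _) (by simp) (by simp)
      (by
        simp [Painting]
        intros
        constructor
        · rintro ⟨x, y, rfl, rfl, rfl⟩
          -- One parametrisation uses the colour before the bar and the other the colour after it,
          -- hence the negation.
          exact ⟨!y, x, by simp⟩
        · rintro ⟨x, y, rfl, rfl, rfl⟩
          exact ⟨y, !x, by simp⟩)
      (by simp [Painting]) fun _ => .refl (by simp)
  | T1_right p q =>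
    exact .of_param [p, q] [q, p] (fun a : Bool × Bool => [a.1, a.2]) (fun a => [!a.2, a.1])
      (fun _ => [⟨[], .virt p q, []⟩]) (fun _ => _) (by simp) (by simp)
      (by
        simp [Painting]
        intros
        constructor
        · rintro ⟨x, y, rfl, rfl, rfl⟩
          exact ⟨x, !y, by simp⟩
        · rintro ⟨x, y, rfl, rfl, rfl⟩
          exact ⟨x, !y, by simp⟩)
      (by simp [Painting]) fun _ => .refl (by simp)
  | T2 d =>
    exact .of_param [d] [d] (fun a : Bool => [a]) (fun a => [a]) (fun _ => []) (fun _ => [])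
      (by simp) (by simp) (fun c c' v _ => by
        simp [Painting]
        constructor
        · rintro ⟨x, rfl, rfl, rfl⟩
          exact ⟨!x, by simp⟩
        · rintro ⟨x, rfl, rfl, rfl⟩
          exact ⟨!x, by simp⟩) painting_nil_one fun _ => .refl (by simp)
  | T3 s p q =>
    refine .of_param [p, q] [q, p] (fun a : Bool × Bool => [a.1, a.2]) (fun a => [a.2, a.1])
      (fun a => crossImage s p q (!a.1) (!a.2))
      (fun a => [⟨[], .virt p q, []⟩] ++ crossImage s q p a.2 a.1 ++ [⟨[], .virt p q, []⟩])
      (by simp) (by simp)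
      (by
        simp [Painting]
        intros
        constructor
        · rintro ⟨x, y, rfl, rfl, rfl⟩
          exact ⟨!y, x, by simp⟩
        · rintro ⟨x, y, rfl, rfl, rfl⟩
          exact ⟨y, !x, by simp⟩)
      (by simp [Painting]) fun a => ?_
    have h := (Deform.virt_virt p q).after (w := [⟨[], .virt p q, []⟩]) (t := [q, p]) (by simp)
    obtain ⟨_ | _, _ | _⟩ := a
    · exact .refl (by simp [crossImage, Event.turn])
    · simpa [crossImage] using h.symm
    · simpa [crossImage] using h.symm
    -- For two `true` strands the bars make the left image a plain crossing, while the right image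
    -- is turned over twice; the surplus consists of two V2 pairs.
    · have h1 := (Deform.virt_virt p q).after (w := [⟨[], .cross s p q, []⟩]) (t := [q, p])
        (by simp)
      have h2 := (Deform.virt_virt q p).before
        (w := [⟨[], .virt p q, []⟩, ⟨[], .virt q p, []⟩, ⟨[], .cross s p q, []⟩]) (s := [p, q])
        (by simp)
      simpa [crossImage, Event.turn] using (h2.trans h1).symm

theorem transports_exchange (e f : Event) (m : List Dir) :
    Transports [⟨[], e, m ++ f.bot⟩, ⟨e.top ++ m, f, []⟩]
      [⟨e.bot ++ m, f, []⟩, ⟨[], e, m ++ f.top⟩] := by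
  have key {e f : Event} {ce ce' cf cf' : List Bool} {ve vf : List Piece}
      (he : e.Paint ce ce' ve) (hf : f.Paint cf cf' vf) :
      Deform VirtMove (e.bot ++ m ++ f.bot) (e.top ++ m ++ f.top)
        (wpad [] (m ++ f.bot) ve ++ wpad (e.top ++ m) [] vf)
        (wpad (e.bot ++ m) [] vf ++ wpad [] (m ++ f.top) ve) := by
    simpa using Deform.exchange_virt he.noBar (noBar_wpad.2 hf.noBar) he.fits
      (hf.fits.wpad m [])
  refine ⟨e.bot ++ m ++ f.bot, e.top ++ m ++ f.top, by simp, by simp, fun c c' v hc => ⟨?_, ?_⟩⟩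
  · rintro ⟨cl, ce, ce', cr, ve, v', hcl, hcr, he, rfl, rfl, dl, cf, cf', dr, vf, v'', hdl, hdr,
      hf, h, rfl, rfl, rfl⟩
    obtain rfl := List.length_eq_zero_iff.1 hcl
    obtain rfl := List.length_eq_zero_iff.1 hdr
    have := he.length_top
    simp only [List.length_append, List.nil_append, List.append_nil] at *
    -- `cm` colours the strands `m` between the events: `dl` and `ce'` are prefixes of the same
    -- list, and `ce'` is not the longer one.
    obtain ⟨cm, rfl⟩ : ∃ cm, dl = ce' ++ cm :=
      (List.prefix_of_prefix_length_le ⟨cr, h⟩ ⟨cf, rfl⟩ (by lia)).imp fun _ h => h.symm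
    obtain rfl : cr = cm ++ cf := by simpa using h
    refine ⟨_, ⟨ce ++ cm, cf, cf', [], vf, _, ?_, rfl, hf, ?_, rfl, [], ce, ce', cm ++ cf', ve, _,
      rfl, ?_, he, ?_, rfl, rfl, ?_⟩, by simpa using key he hf⟩ <;>
      simp_all [he.length_bot, hf.length_top]
  · rintro ⟨dl, cf, cf', dr, vf, v', hdl, hdr, hf, rfl, rfl, cl, ce, ce', cr, ve, v'', hcl, hcr,
      he, h, rfl, rfl, rfl⟩
    obtain rfl := List.length_eq_zero_iff.1 hcl
    obtain rfl := List.length_eq_zero_iff.1 hdr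
    have := he.length_bot
    simp only [List.length_append, List.nil_append, List.append_nil] at *
    obtain ⟨cm, rfl⟩ : ∃ cm, dl = ce ++ cm :=
      (List.prefix_of_prefix_length_le ⟨cr, h.symm⟩ ⟨cf', rfl⟩ (by lia)).imp fun _ h => h.symm
    obtain rfl : cr = cm ++ cf' := by simpa using h.symm
    refine ⟨_, ⟨[], ce, ce', cm ++ cf, ve, _, rfl, ?_, he, ?_, rfl, ce' ++ cm, cf, cf', [], vf, _,
      ?_, rfl, hf, ?_, rfl, rfl, ?_⟩, by simpa using (key he hf).symm⟩ <;>
      simp_all [he.length_top, hf.length_bot]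

/-- A classical crossing slid through an extremum keeps its two colours, so the image is the same
slide, its virtual version or its turned-over version. A bar slid over an extremum only changes the
colour attached to the extremum, which the image does not see. -/
theorem Isotopy.transports {w w' : List Piece} (h : Isotopy w w') : Transports w w' := by
  have h0 := h
  have hM : (Isotopy ⊔ ClassicalMove ⊔ VirtualMove) w w' := Or.inl (Or.inl h)
  cases h with
  | exchange e f m => exact transports_exchange e f m
  | zigzag_left d =>
    exact .of_param [d] [d] (fun a : Bool => [a]) (fun a => [a]) (fun _ => _) (fun _ => [])
      (by simp) (by simp) (by simp [Painting]) painting_nil_one fun _ =>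
      .isotopy h0 (by simp) (by simp) (by simp) (by simp)
  | zigzag_right d =>
    exact .of_param [d] [d] (fun a : Bool => [a]) (fun a => [a]) (fun _ => _) (fun _ => [])
      (by simp) (by simp) (by simp [Painting]) painting_nil_one fun _ =>
      .isotopy h0 (by simp) (by simp) (by simp) (by simp)
  | max_cross s p q =>
    refine .of_param [p, q, p.flip] [q] (fun a : Bool × Bool => [a.1, a.2, a.1]) (fun a => [a.2])
      (fun a => wpad [p] [] (crossImage s q p.flip a.2 a.1) ++ [⟨[], .max p, [q]⟩])
      (fun a => wpad [] [p.flip] (crossImage (!s) p q a.1 a.2) ++ [⟨[q], .max p, []⟩])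
      (by simp) (by simp) (by simp [Painting]) (by simp [Painting]) fun a => ?_
    obtain ⟨_ | _, _ | _⟩ := a
    · exact .isotopy h0 (by simp [crossImage]) (by simp [crossImage]) (by simp [crossImage])
        (by simp [crossImage])
    · exact .isotopy (.max_virt p q) (by simp [crossImage]) (by simp [crossImage])
        (by simp [crossImage]) (by simp [crossImage])
    · exact .isotopy (.max_virt p q) (by simp [crossImage]) (by simp [crossImage])
        (by simp [crossImage]) (by simp [crossImage])
    · simpa [turnWord, Piece.turn, Event.turn, crossImage] using
        Deform.turn_move (s := [p, q, p.flip]) (t := [q]) hM (by simp) (by simp) (by simp)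
          (by simp)
  | min_cross s p q =>
    refine .of_param [q] [p, q, p.flip] (fun a : Bool × Bool => [a.2]) (fun a => [a.1, a.2, a.1])
      (fun a => [⟨[], .min p, [q]⟩] ++ wpad [p] [] (crossImage s p.flip q a.1 a.2))
      (fun a => [⟨[q], .min p, []⟩] ++ wpad [] [p.flip] (crossImage (!s) q p a.2 a.1))
      (by simp) (by simp) (by simp [Painting])
      (fun c c' v _ => by
        simp [Painting]
        exact ⟨fun ⟨a, h, x, h'⟩ => ⟨x, a, h, h'⟩, fun ⟨x, a, h, h'⟩ => ⟨a, h, x, h'⟩⟩) fun a => ?_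
    obtain ⟨_ | _, _ | _⟩ := a
    · exact .isotopy h0 (by simp [crossImage]) (by simp [crossImage]) (by simp [crossImage])
        (by simp [crossImage])
    · exact .isotopy (.min_virt p q) (by simp [crossImage]) (by simp [crossImage])
        (by simp [crossImage]) (by simp [crossImage])
    · exact .isotopy (.min_virt p q) (by simp [crossImage]) (by simp [crossImage])
        (by simp [crossImage]) (by simp [crossImage])
    · simpa [turnWord, Piece.turn, Event.turn, crossImage] using
        Deform.turn_move (s := [q]) (t := [p, q, p.flip]) hM (by simp) (by simp) (by simp)
          (by simp)
  | max_virt p q =>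
    exact .of_param [p, q, p.flip] [q] (fun a : Bool × Bool => [a.1, a.2, a.1]) (fun a => [a.2])
      (fun _ => _) (fun _ => _)
      (by simp) (by simp) (by simp [Painting]) (by simp [Painting]) fun a =>
      .isotopy h0 (by simp) (by simp) (by simp) (by simp)
  | min_virt p q =>
    exact .of_param [q] [p, q, p.flip] (fun a : Bool × Bool => [a.2]) (fun a => [a.1, a.2, a.1])
      (fun _ => _) (fun _ => _)
      (by simp) (by simp) (by simp [Painting])
      (fun c c' v _ => by
        simp [Painting]
        exact ⟨fun ⟨a, h, h', x, h''⟩ => ⟨x, a, h, h', h''⟩,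
          fun ⟨x, a, h, h', h''⟩ => ⟨a, h, h', x, h''⟩⟩) fun a =>
      .isotopy h0 (by simp) (by simp) (by simp) (by simp)
  | max_bar d =>
    exact .of_param [d, d.flip] [] (fun a : Bool => [a, !a]) (fun _ => [])
      (fun _ => [⟨[], .max d, []⟩]) (fun _ => _)
      (by simp) (by simp)
      (fun c c' v _ => by
        simp [Painting]
        intros
        constructor <;> (rintro ⟨x, rfl⟩; exact ⟨!x, by simp⟩))
      (by simp [Painting]) fun _ => .refl (by simp)
  | min_bar d =>
    exact .of_param [] [d, d.flip] (fun _ : Bool => []) (fun a => [!a, a])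
      (fun _ => [⟨[], .min d, []⟩]) (fun _ => _)
      (by simp) (by simp) (by simp [Painting])
      (fun c c' v _ => by
        simp [Painting]
        intros
        constructor <;> (rintro ⟨x, rfl⟩; exact ⟨!x, by simp⟩)) fun _ => .refl (by simp)

end Moves


/-! ### Transporting paintings along moves of closed diagrams -/

theorem Painting.fits {w v : List Piece} {c c' : List Bool} {s t : List Dir}
    (h : Painting w c c' v) (hw : Fits s w t) (hc : c.length = s.length) :
    c'.length = t.length ∧ Fits s v t := by
  induction w generalizing s c v with
  | nil =>
    obtain ⟨rfl, rfl⟩ := h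
    obtain rfl : s = t := hw
    exact ⟨hc, rfl⟩
  | cons p w ih =>
    rcases p with ⟨l, e, r⟩
    obtain ⟨cl, ce, ce', cr, ve, v', hl, hr, he, rfl, rfl, h⟩ := h
    obtain ⟨rfl, hw⟩ := hw
    obtain ⟨h1, h2⟩ := ih h hw (by simp [Piece.top, hl, hr, he.length_top])
    exact ⟨h1, (he.fits.wpad l r).append h2⟩

theorem painting_append {u w v : List Piece} {c c'' : List Bool} :
    Painting (u ++ w) c c'' v ↔
      ∃ c' v₁ v₂, v = v₁ ++ v₂ ∧ Painting u c c' v₁ ∧ Painting w c' c'' v₂ := by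
  induction u generalizing c v with
  | nil => simp [Painting]
  | cons p u ih =>
    rcases p with ⟨l, e, r⟩
    simp only [Painting, List.cons_append, ih]
    constructor
    · rintro ⟨cl, ce, ce', cr, ve, v', hl, hr, he, hc, rfl, c', v₁, v₂, rfl, h₁, h₂⟩
      exact ⟨c', ve.map _ ++ v₁, v₂, by simp [wpad],
        ⟨cl, ce, ce', cr, ve, v₁, hl, hr, he, hc, rfl, h₁⟩, h₂⟩
    · rintro ⟨c', _, v₂, rfl, ⟨cl, ce, ce', cr, ve, v₁, hl, hr, he, hc, rfl, h₁⟩, h₂⟩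
      exact ⟨cl, ce, ce', cr, ve, v₁ ++ v₂, hl, hr, he, hc, by simp, c', v₁, v₂, rfl, h₁, h₂⟩

/-- Colours of padding strands never change, and the prescribed lengths make the splitting of each
colour list unique. -/
theorem painting_wpad {w V : List Piece} {l r s t : List Dir} {cl cr c C' : List Bool}
    (hl : cl.length = l.length) (hr : cr.length = r.length) (hw : Fits s w t)
    (hc : c.length = s.length) :
    Painting (wpad l r w) (cl ++ c ++ cr) C' V ↔
      ∃ c' v, C' = cl ++ c' ++ cr ∧ V = wpad l r v ∧ Painting w c c' v := by
  induction w generalizing s c V with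
  | nil =>
    simp only [wpad_nil, Painting]
    constructor
    · rintro ⟨rfl, rfl⟩
      exact ⟨c, [], rfl, rfl, rfl, rfl⟩
    · rintro ⟨_, _, rfl, rfl, rfl, rfl⟩
      exact ⟨rfl, rfl⟩
  | cons p w ih =>
    rcases p with ⟨pl, e, pr⟩
    obtain ⟨rfl, hw⟩ := hw
    simp only [Piece.bot, List.length_append] at hc
    constructor
    · rintro ⟨dl, ce, ce', dr, ve, V', hdl, hdr, he, h, rfl, hV⟩
      have hce := he.length_bot
      simp only [List.length_append] at hdl hdr
      obtain ⟨pcl, rfl⟩ : ∃ x, dl = cl ++ x :=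
        (List.prefix_of_prefix_length_le ⟨c ++ cr, rfl⟩
          ⟨ce ++ dr, by simpa using h.symm⟩ (by lia)).imp fun _ h => h.symm
      obtain ⟨pcr, rfl⟩ : ∃ x, dr = x ++ cr :=
        (List.suffix_of_suffix_length_le ⟨cl ++ c, rfl⟩
          ⟨cl ++ pcl ++ ce, by simpa using h.symm⟩ (by lia)).imp fun _ h => h.symm
      obtain rfl : c = pcl ++ ce ++ pcr :=
        List.append_cancel_right (bs := cr) (by simpa using h)
      simp only [List.length_append] at hdl hdr
      obtain ⟨c', v, rfl, rfl, h'⟩ := (ih (c := pcl ++ ce' ++ pcr) hw (by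
        simp only [Piece.top, List.length_append, he.length_top]
        lia)).1 (by simpa [wpad] using hV)
      exact ⟨c', _, rfl, by simp, pcl, ce, ce', pcr, ve, v, by lia, by lia, he, rfl, rfl, h'⟩
    · rintro ⟨c', _, rfl, rfl, pcl, ce, ce', pcr, ve, v, hpl, hpr, he, rfl, rfl, h⟩
      refine ⟨cl ++ pcl, ce, ce', pcr ++ cr, ve, wpad l r v, by simp [hl, hpl],
        by simp [hr, hpr], he, by simp, by simp, ?_⟩
      have := (ih (c := pcl ++ ce' ++ pcr) hw
        (by simp [Piece.top, hpl, hpr, he.length_top])).2 ⟨c', v, rfl, rfl, h⟩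
      simpa [wpad] using this

theorem Fits.bot_unique {s s' t t' : List Dir} {w : List Piece} (hw : w ≠ []) (h : Fits s w t)
    (h' : Fits s' w t') : s = s' := by
  cases w with
  | nil => exact absurd rfl hw
  | cons p w => exact h.1.symm.trans h'.1

theorem Transports.symm {w w' : List Piece} (h : Transports w w') : Transports w' w := by
  obtain ⟨s, t, hw, hw', h⟩ := h
  exact ⟨s, t, hw', hw, fun c c' v hc => (h c c' v hc).symm⟩

theorem Transports.closed {w w' below above V : List Piece} {l r : List Dir}
    (hT : Transports w w') (hu : Fits [] (below ++ wpad l r w ++ above) [])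
    (hv : Fits [] (below ++ wpad l r w' ++ above) [])
    (hV : Painting (below ++ wpad l r w ++ above) [] [] V) :
    ∃ V', Painting (below ++ wpad l r w' ++ above) [] [] V' ∧ Deform VirtMove [] [] V V' := by
  obtain ⟨s, t, hw, hw', hT⟩ := hT
  obtain ⟨m', hu', ha⟩ := fits_append.1 hu
  obtain ⟨m, hb, hm⟩ := fits_append.1 hu'
  obtain ⟨n', hv', -⟩ := fits_append.1 hv
  obtain ⟨n, hb', hn⟩ := fits_append.1 hv'
  obtain rfl := hb.unique hb'
  -- An empty word fits on every boundary, so the boundary `m` can be identified with `l ++ s ++ r`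
  -- only through a nonempty side of the move.
  by_cases hne : w = [] ∧ w' = []
  · obtain ⟨rfl, rfl⟩ := hne
    exact ⟨V, hV, .refl (hV.fits hu rfl).2⟩
  have hms : m = l ++ s ++ r := by
    rcases not_and_or.1 hne with h | h
    · exact Fits.bot_unique (by simpa [wpad] using h) hm (hw.wpad l r)
    · exact Fits.bot_unique (by simpa [wpad] using h) hn (hw'.wpad l r)
  subst hms
  obtain rfl := hm.unique (hw.wpad l r)
  obtain ⟨C', V₁, V₃, rfl, hV', hV₃⟩ := painting_append.1 hV
  obtain ⟨C, V₁, V₂, rfl, hV₁, hV₂⟩ := painting_append.1 hV'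
  obtain ⟨hC, hf₁⟩ := hV₁.fits hb rfl
  obtain ⟨cl, c, cr, hl, hc, hr, rfl⟩ : ∃ cl c cr, cl.length = l.length ∧ c.length = s.length ∧
      cr.length = r.length ∧ C = cl ++ c ++ cr := by
    simp only [List.length_append] at hC
    refine ⟨C.take l.length, (C.drop l.length).take s.length, (C.drop l.length).drop s.length,
      ?_, ?_, ?_, by simp only [List.append_assoc, List.take_append_drop]⟩ <;> simp <;> lia
  obtain ⟨c', v, rfl, rfl, hv⟩ := (painting_wpad hl hr hw hc).1 hV₂
  obtain ⟨v', hv', hD⟩ := (hT c c' v hc).1 hv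
  have hf₃ := (hV₃.fits ha (by simp [hl, hr, (hv.fits hw hc).1])).2
  exact ⟨V₁ ++ wpad l r v' ++ V₃, painting_append.2 ⟨_, _, _, rfl, painting_append.2
    ⟨_, _, _, rfl, hV₁, (painting_wpad hl hr hw' hc).2 ⟨c', v', rfl, rfl, hv'⟩⟩, hV₃⟩,
    hD.inside _ _ l r hf₁ hf₃⟩

theorem transports_of_move {w w' : List Piece}
    (h : (Isotopy ⊔ ClassicalMove ⊔ VirtualMove ⊔ TwistedMove) w w') : Transports w w' := by
  rcases h with ((h | h) | h) | h
  exacts [h.transports, h.transports, h.transports, h.transports]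

theorem TwistedStep.transport {D D' : TwistedDiagram} (h : TwistedStep D D') :
    (∀ V, Painting D.word [] [] V →
      ∃ V', Painting D'.word [] [] V' ∧ Deform VirtMove [] [] V V') ∧
    (∀ V, Painting D'.word [] [] V →
      ∃ V', Painting D.word [] [] V' ∧ Deform VirtMove [] [] V V') := by
  obtain ⟨b, a, l, r, w, w', hM, h1, h2⟩ := h
  have hD := D.closed
  have hD' := D'.closed
  rw [h1] at hD
  rw [h2] at hD'
  rw [h1, h2]
  exact ⟨fun V hV => (transports_of_move hM).closed hD hD' hV,
    fun V hV => (transports_of_move hM).symm.closed hD' hD hV⟩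

theorem transport_of_eqvGen {D D' : TwistedDiagram} (h : Relation.EqvGen TwistedStep D D') :
    (∀ V, Painting D.word [] [] V →
      ∃ V', Painting D'.word [] [] V' ∧ Deform VirtMove [] [] V V') ∧
    (∀ V, Painting D'.word [] [] V →
      ∃ V', Painting D.word [] [] V' ∧ Deform VirtMove [] [] V V') := by
  induction h with
  | rel _ _ h => exact h.transport
  | refl D => exact ⟨fun V hV => ⟨V, hV, .refl (hV.fits D.closed rfl).2⟩,
      fun V hV => ⟨V, hV, .refl (hV.fits D.closed rfl).2⟩⟩
  | symm _ _ _ ih => exact ih.symm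
  | trans _ _ _ _ _ ih ih' =>
    constructor
    · intro V hV
      obtain ⟨V', hV', h⟩ := ih.1 V hV
      obtain ⟨V'', hV'', h'⟩ := ih'.1 V' hV'
      exact ⟨V'', hV'', h.trans h'⟩
    · intro V hV
      obtain ⟨V', hV', h⟩ := ih'.2 V hV
      obtain ⟨V'', hV'', h'⟩ := ih.2 V' hV'
      exact ⟨V'', hV'', h.trans h'⟩

/-! ### Paintings of bar-free diagrams -/

theorem painting_false {s t : List Dir} {w : List Piece} (hw : Fits s w t) (hn : NoBar w) :
    Painting w (s.map fun _ => false) (t.map fun _ => false) w := by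
  induction w generalizing s with
  | nil =>
    obtain rfl : s = t := hw
    exact ⟨rfl, rfl⟩
  | cons p w ih =>
    rcases p with ⟨l, e, r⟩
    obtain ⟨rfl, hw⟩ := hw
    have hn := noBar_cons.1 hn
    refine ⟨l.map fun _ => false, e.bot.map fun _ => false, e.top.map fun _ => false,
      r.map fun _ => false, [⟨[], e, []⟩], w, by simp, by simp, ?_,
      by simp only [Piece.bot, List.map_append], by simp, by simpa only [Piece.top, List.map_append] using ih hw hn.2⟩
    cases e with
    | cross s p q => exact .cross s p q false false
    | bar d => exact absurd rfl (hn.1 d)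
    | _ => constructor

theorem Piece.Joins.of_succ {p : Piece} {k : ℕ} {x y : ℕ × ℕ} (h : p.Joins (k + 1) x y) :
    ∃ x' y', x = (x'.1 + 1, x'.2) ∧ y = (y'.1 + 1, y'.2) ∧ p.Joins k x' y' := by
  cases h with
  | lft l e r j hj => exact ⟨_, _, rfl, rfl, .lft l e r j hj⟩
  | rgt l e r j hj => exact ⟨_, _, rfl, rfl, .rgt l e r j hj⟩
  | max l d r => exact ⟨_, _, rfl, rfl, .max l d r⟩
  | min l d r => exact ⟨(k + 1, _), (k + 1, _), rfl, rfl, .min l d r⟩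
  | cross_ne l s p q r => exact ⟨_, _, rfl, rfl, .cross_ne l s p q r⟩
  | cross_nw l s p q r => exact ⟨_, _, rfl, rfl, .cross_nw l s p q r⟩
  | virt_ne l p q r => exact ⟨_, _, rfl, rfl, .virt_ne l p q r⟩
  | virt_nw l p q r => exact ⟨_, _, rfl, rfl, .virt_nw l p q r⟩
  | bar l d r => exact ⟨_, _, rfl, rfl, .bar l d r⟩

/-- A painting of a bar-free word colours its points, joined points have the same colour, and the
image is determined if only one colour occurs. -/
theorem Painting.exists_color {w v : List Piece} {c c' : List Bool} (h : Painting w c c' v)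
    (hn : NoBar w) :
    ∃ γ : ℕ × ℕ → Bool, (∀ j, γ (0, j) = c.getD j false) ∧
      (∀ (k : ℕ) (p : Piece) (x y : ℕ × ℕ), w[k]? = some p → p.Joins k x y → γ x = γ y) ∧
      ∀ a, (∀ k p j, w[k]? = some p → j < p.bot.length → γ (k, j) = a) →
        v = if a then turnWord w else w := by
  induction w generalizing c v with
  | nil =>
    obtain ⟨rfl, rfl⟩ := h
    exact ⟨fun x => c'.getD x.2 false, by simp, by simp, by simp [turnWord]⟩
  | cons p w ih =>
    rcases p with ⟨l, e, r⟩
    obtain ⟨cl, ce, ce', cr, ve, v, hl, hr, he, rfl, rfl, h⟩ := h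
    have hn := noBar_cons.1 hn
    obtain ⟨γ, h0, hJ, hv⟩ := ih h hn.2
    have hb := he.length_bot
    have ht := he.length_top
    -- The lowest line is coloured by the entering colours, the higher lines by the colouring of the
    -- rest; the default `false` occurs only off the diagram.
    refine ⟨fun x => match x with
      | (0, j) => (cl ++ ce ++ cr).getD j false
      | (k + 1, j) => γ (k, j), fun _ => rfl, ?_, ?_⟩
    · rintro (_ | k) p x y hp hxy
      · obtain rfl : ⟨l, e, r⟩ = p := by simpa using hp
        cases hxy with
        | lft _ _ _ j hj =>
          have e1 (x : List Bool) : (cl ++ x).getD j false = cl.getD j false :=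
            List.getD_append _ _ _ _ (by lia)
          simp only [h0, List.append_assoc, e1]
        | rgt _ _ _ j hj =>
          have e1 : (cl ++ ce ++ cr).getD (l.length + e.bot.length + j) false =
              cr.getD j false := by
            rw [List.getD_append_right _ _ _ _ (by simp; lia)]
            congr 1; simp; lia
          have e2 : (cl ++ ce' ++ cr).getD (l.length + e.top.length + j) false =
              cr.getD j false := by
            rw [List.getD_append_right _ _ _ _ (by simp; lia)]
            congr 1; simp; lia
          simp only [h0, e1, e2]
        | max _ d _ => cases he; simp [← hl]
        | min _ d _ => cases he; simp [h0, ← hl]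
        | cross_ne _ s p q _ => cases he; simp [h0, ← hl]
        | cross_nw _ s p q _ => cases he; simp [h0, ← hl]
        | virt_ne _ p q _ => cases he; simp [h0, ← hl]
        | virt_nw _ p q _ => cases he; simp [h0, ← hl]
        | bar _ d _ => exact absurd rfl (hn.1 d)
      · obtain ⟨x', y', rfl, rfl, h'⟩ := hxy.of_succ
        exact hJ k p x' y' (by simpa using hp) h'
    · intro a ha
      have hv := hv a fun k p j hp hj => ha (k + 1) p j (by simpa using hp) hj
      -- Knowing the colours that enter the event is enough: only crossings have colour-dependent
      -- images, and all their colours enter from below.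
      have h1 (j : ℕ) (hj : j < e.bot.length) : ce.getD j false = a := by
        have := ha 0 ⟨l, e, r⟩ (l.length + j) rfl (by simp [Piece.bot]; lia)
        change (cl ++ ce ++ cr).getD (l.length + j) false = a at this
        rw [← this, ← hl, List.append_assoc, List.getD_append_right _ _ _ _ (by simp),
          List.getD_append _ _ _ _ (by simp; lia)]
        simp
      rw [hv]
      cases e with
      | cross s p q =>
        cases he with
        | cross _ _ _ x y =>
          obtain rfl : x = a := by simpa using h1 0 (by simp [Event.bot])
          obtain rfl : y = x := by simpa using h1 1 (by simp [Event.bot])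
          cases y <;> simp [turnWord, Piece.turn, Event.turn, crossImage]
      | bar d => exact absurd rfl (hn.1 d)
      | _ => cases he; cases a <;> simp [turnWord, Piece.turn, Event.turn]

/-- Without bars, colours are constant along arcs and descend to a function on components; a single
component leaves one colour. -/
theorem Painting.eq_of_isKnot {D : VirtualDiagram} {V : List Piece} (hD : D.IsKnot)
    (h : Painting D.word [] [] V) : V = D.word ∨ V = turnWord D.word := by
  obtain ⟨γ, -, hJ, hV⟩ := h.exists_color D.no_bar
  obtain ⟨hs, ⟨c⟩⟩ := Nat.card_eq_one_iff_unique.1 hD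
  let f : D.Component → Bool := Quot.lift (fun x => γ x.1) fun x y ⟨k, p, hp, h⟩ => hJ k p _ _ hp h
  have := hV (f c) fun k p j hp hj =>
    congrArg f (hs.elim (Quot.mk _ ⟨(k, j), p, hp, hj⟩) c)
  cases hc : f c
  · exact Or.inl (by simpa [hc] using this)
  · exact Or.inr (by simpa [hc] using this)

/-! ### Deformations of closed diagrams -/

/-- Stacking and padding are absorbed into the surrounding context, which is therefore generalised
in the induction; what remains is a chain of local moves. -/
theorem Deform.eqvGen {M : List Piece → List Piece → Prop} {s t S T : List Dir}
    {u v : List Piece} (h : Deform M s t u v) (below above : List Piece) (l r : List Dir)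
    (hb : Fits S below (l ++ s ++ r)) (ha : Fits (l ++ t ++ r) above T) :
    Relation.EqvGen (fun x y => Fits S x T ∧ Fits S y T ∧ Local M x y)
      (below ++ wpad l r u ++ above) (below ++ wpad l r v ++ above) := by
  induction h generalizing below above l r with
  | refl => exact .refl _
  | move h hu hv =>
    exact .rel _ _ ⟨(hb.append (hu.wpad l r)).append ha, (hb.append (hv.wpad l r)).append ha,
      _, _, l, r, _, _, h, rfl, rfl⟩
  | symm _ ih => exact .symm _ _ (ih _ _ l r hb ha)
  | trans _ _ ih ih' => exact .trans _ _ _ (ih _ _ l r hb ha) (ih' _ _ l r hb ha)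
  | @comp s m t u v u' v' h h' ih ih' =>
    have h1 := ih below (wpad l r u' ++ above) l r hb ((h'.fits.1.wpad l r).append ha)
    have h2 := ih' (below ++ wpad l r v) above l r (hb.append (h.fits.2.wpad l r)) ha
    exact .trans _ _ _ (by simpa using h1) (by simpa using h2)
  | pad l' r' _ ih =>
    simpa using ih below above (l ++ l') (r' ++ r) (by simpa using hb) (by simpa using ha)

/-- The chain of moves runs through words, the quotient is one of diagrams. Closedness and absence
of bars are carried along the chain, so that each intermediate word is a diagram. -/
theorem Deform.mk_virtual_eq {D D' : VirtualDiagram}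
    (h : Deform VirtMove [] [] D.word D'.word) :
    Quot.mk VirtualStep D = Quot.mk VirtualStep D' := by
  have key : ∀ x y, Relation.EqvGen (fun x y => Fits [] x [] ∧ Fits [] y [] ∧
      Local VirtMove x y) x y → ((Fits [] x [] ∧ NoBar x) ↔ (Fits [] y [] ∧ NoBar y)) ∧
      ∀ D D' : VirtualDiagram, D.word = x → D'.word = y →
        Quot.mk VirtualStep D = Quot.mk VirtualStep D' := by
    intro x y h
    induction h with
    | rel x y h =>
      obtain ⟨hx, hy, b, a, l, r, w, w', ⟨hM, hw, hw'⟩, rfl, rfl⟩ := h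
      have n {w : List Piece} (h : NoBar w) : NoBar (w.map (Piece.pad l r)) :=
        noBar_wpad.2 h
      refine ⟨⟨fun h => ⟨hy, ?_⟩, fun h => ⟨hx, ?_⟩⟩, fun D D' h h' => Quot.sound ?_⟩
      · simpa [n hw, n hw'] using h.2
      · simpa [n hw, n hw'] using h.2
      · exact ⟨b, a, l, r, w, w', hM, h, h'⟩
    | refl x =>
      refine ⟨Iff.rfl, fun D D' h h' => ?_⟩
      obtain ⟨⟨w, _⟩, _⟩ := D
      obtain ⟨⟨w', _⟩, _⟩ := D'
      obtain rfl : w = w' := h.trans h'.symm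
      rfl
    | symm _ _ _ ih => exact ⟨ih.1.symm, fun D D' h h' => (ih.2 D' D h' h).symm⟩
    | trans x y z _ _ ih ih' =>
      refine ⟨ih.1.trans ih'.1, fun D D' h h' => ?_⟩
      have hy := ih.1.1 ⟨h ▸ D.closed, h ▸ D.no_bar⟩
      exact (ih.2 D ⟨⟨y, hy.1⟩, hy.2⟩ h rfl).trans (ih'.2 _ D' rfl h')
  refine (key _ _ ?_).2 D D' rfl rfl
  simpa using h.eqvGen [] [] [] [] rfl rfl

theorem Deform.mk_twisted_eq {D D' : TwistedDiagram}
    (h : Deform (Isotopy ⊔ ClassicalMove ⊔ VirtualMove ⊔ TwistedMove) [] [] D.word D'.word) :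
    Quot.mk TwistedStep D = Quot.mk TwistedStep D' := by
  have key : ∀ x y, Relation.EqvGen (fun x y => Fits [] x [] ∧ Fits [] y [] ∧
      Local (Isotopy ⊔ ClassicalMove ⊔ VirtualMove ⊔ TwistedMove) x y) x y →
      (Fits [] x [] ↔ Fits [] y []) ∧ ∀ D D' : TwistedDiagram, D.word = x → D'.word = y →
        Quot.mk TwistedStep D = Quot.mk TwistedStep D' := by
    intro x y h
    induction h with
    | rel x y h =>
      obtain ⟨hx, hy, h⟩ := h
      refine ⟨by simp [hx, hy], ?_⟩
      rintro D D' rfl rfl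
      exact Quot.sound h
    | refl x =>
      refine ⟨Iff.rfl, fun D D' h h' => ?_⟩
      obtain ⟨w, _⟩ := D
      obtain ⟨w', _⟩ := D'
      obtain rfl : w = w' := h.trans h'.symm
      rfl
    | symm _ _ _ ih => exact ⟨ih.1.symm, fun D D' h h' => (ih.2 D' D h' h).symm⟩
    | trans x y z _ _ ih ih' =>
      refine ⟨ih.1.trans ih'.1, fun D D' h h' => ?_⟩
      exact (ih.2 D ⟨y, ih.1.1 (h ▸ D.closed)⟩ h rfl).trans (ih'.2 _ D' rfl h')
  refine (key _ _ ?_).2 D D' rfl rfl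
  simpa using h.eqvGen [] [] [] [] rfl rfl

/-! ### Bars on all strands -/

/-- The moves of twisted links. -/
abbrev TwistMove : List Piece → List Piece → Prop :=
  Isotopy ⊔ ClassicalMove ⊔ VirtualMove ⊔ TwistedMove

/-- A bar on each strand. -/
def bars : List Dir → List Piece
  | [] => []
  | d :: m => ⟨[], .bar d, m⟩ :: wpad [d] [] (bars m)

theorem bars_append (m n : List Dir) :
    bars (m ++ n) = wpad [] n (bars m) ++ wpad m [] (bars n) := by
  induction m with
  | nil => simp [bars]
  | cons b m ih => simp [bars, ih]

theorem fits_bars (m : List Dir) : Fits m (bars m) m := by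
  induction m with
  | nil => simp [bars]
  | cons b m ih => simpa [bars, Event.bot, Event.top] using ih.wpad [b] []

namespace Deform

variable {s t : List Dir} {u v : List Piece}

theorem isotopy_twist (h : Isotopy u v) (hu : Fits s u t) (hv : Fits s v t) :
    Deform TwistMove s t u v := .move (Or.inl (Or.inl (Or.inl h))) hu hv

theorem twisted (h : TwistedMove u v) (hu : Fits s u t) (hv : Fits s v t) :
    Deform TwistMove s t u v := .move (Or.inr h) hu hv

theorem exchange_twist {s' t' : List Dir} (hu : Fits s u t) (hv : Fits s' v t') :
    Deform TwistMove (s ++ s') (t ++ t') (wpad [] s' u ++ wpad t [] v)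
      (wpad s [] v ++ wpad [] t' u) :=
  exchange (fun _ _ _ _ _ => Or.inl (Or.inl (Or.inl (.exchange _ _ _)))) hu hv

theorem bar_bar (d : Dir) :
    Deform TwistMove [d] [d] [⟨[], .bar d, []⟩, ⟨[], .bar d, []⟩] [] :=
  twisted (.T2 d) (by simp [Event.bot, Event.top]) (by simp)

end Deform

attribute [local simp] Event.bot Event.top in
-- At an extremum one bar slides over to the other leg and cancels there. At a classical crossing T3
-- produces bars on all four legs, and the lower two cancel against the given row. At a virtual
-- crossing both bars pass by T1.
theorem bars_turn_event (e : Event) (he : ∀ d, e ≠ .bar d) :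
    Deform TwistMove e.bot e.top (⟨[], e, []⟩ :: bars e.top) (bars e.bot ++ e.turn) := by
  cases e with
  | max d =>
    have h1 := (Deform.isotopy_twist (s := [d, d.flip]) (t := []) (.max_bar d) (by simp)
      (by simp)).before (w := [⟨[], .bar d, [d.flip]⟩]) (s := [d, d.flip]) (by simp)
    have h2 := (Deform.bar_bar d).inside [] [⟨[], .max d, []⟩] [] [d.flip] (S := [d, d.flip])
      (T := []) (by simp) (by simp)
    simpa [bars, Event.turn] using (h1.symm.trans (by simpa using h2)).symm
  | min d =>
    have h1 := (Deform.isotopy_twist (s := []) (t := [d, d.flip]) (.min_bar d) (by simp)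
      (by simp)).after (w := [⟨[d], .bar d.flip, []⟩]) (t := [d, d.flip]) (by simp)
    have h2 := (Deform.bar_bar d.flip).inside [⟨[], .min d, []⟩] [] [d] [] (S := [])
      (T := [d, d.flip]) (by simp) (by simp)
    simpa [bars, Event.turn] using h1.trans (by simpa using h2)
  | cross s p q =>
    have h1 := (Deform.twisted (s := [p, q]) (t := [q, p]) (.T3 s p q) (by simp)
      (by simp)).before (w := [⟨[], .bar p, [q]⟩, ⟨[p], .bar q, []⟩]) (s := [p, q]) (by simp)
    have h2 := (Deform.isotopy_twist (s := [p, q]) (t := [p, q]) (.exchange (.bar p) (.bar q) [])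
      (by simp) (by simp)).after (w := [⟨[], .bar p, [q]⟩, ⟨[p], .bar q, []⟩,
        ⟨[], .cross s p q, []⟩, ⟨[], .bar q, [p]⟩, ⟨[q], .bar p, []⟩]) (t := [q, p]) (by simp)
    have h3 := (Deform.bar_bar p).inside [⟨[p], .bar q, []⟩] [⟨[p], .bar q, []⟩,
        ⟨[], .cross s p q, []⟩, ⟨[], .bar q, [p]⟩, ⟨[q], .bar p, []⟩] [] [q] (S := [p, q])
        (T := [q, p]) (by simp) (by simp)
    have h4 := (Deform.bar_bar q).inside [] [⟨[], .cross s p q, []⟩, ⟨[], .bar q, [p]⟩,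
      ⟨[q], .bar p, []⟩] [p] [] (S := [p, q]) (T := [q, p]) (by simp) (by simp)
    simp at h1 h2 h3 h4
    simpa [bars, Event.turn] using ((h1.symm.trans h2).trans (h3.trans h4)).symm
  | virt p q =>
    have h1 := (Deform.twisted (s := [p, q]) (t := [q, p]) (.T1_right p q) (by simp)
      (by simp)).before (w := [⟨[], .bar p, [q]⟩]) (s := [p, q]) (by simp)
    have h2 := (Deform.twisted (s := [p, q]) (t := [q, p]) (.T1_left p q) (by simp)
      (by simp)).after (w := [⟨[], .bar q, [p]⟩]) (t := [q, p]) (by simp)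
    have h3 := (Deform.isotopy_twist (s := [q, p]) (t := [q, p]) (.exchange (.bar q) (.bar p) [])
      (by simp) (by simp)).before (w := [⟨[], .virt p q, []⟩]) (s := [p, q]) (by simp)
    simp at h1 h2 h3
    simpa [bars, Event.turn] using ((h1.trans h2).trans h3.symm).symm
  | bar d => exact absurd rfl (he d)

theorem bars_turn_piece (p : Piece) (hp : ∀ d, p.event ≠ .bar d) :
    Deform TwistMove p.bot p.top (p :: bars p.top) (bars p.bot ++ p.turn) := by
  rcases p with ⟨l, e, r⟩
  have hl := (fits_bars l).wpad [] (e.bot ++ r)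
  have hr := (fits_bars r).wpad (l ++ e.top) []
  have ht := (fits_bars e.top).wpad l r
  have h1 := (Deform.exchange_twist (v := [⟨[], e, []⟩]) (s' := e.bot) (t' := e.top)
    (fits_bars l) (by simp)).inside [] (wpad l r (bars e.top) ++ wpad (l ++ e.top) [] (bars r))
      [] r (S := l ++ e.bot ++ r) (T := l ++ e.top ++ r) (by simp)
      (Fits.append (by simpa using ht) (by simpa using hr))
  have h2 := (bars_turn_event e hp).inside (wpad [] (e.bot ++ r) (bars l))
    (wpad (l ++ e.top) [] (bars r)) l r (by simpa using hl) (by simpa using hr)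
  have h3 := (Deform.exchange_twist e.fits_turn (fits_bars r)).inside
    (wpad [] (e.bot ++ r) (bars l) ++ wpad l r (bars e.bot)) [] l [] (S := l ++ e.bot ++ r)
    (T := l ++ e.top ++ r)
    (Fits.append (by simpa using hl) (by simpa using (fits_bars e.bot).wpad l r)) (by simp)
  simp only [Piece.bot, Piece.top, bars_append]
  refine .trans (by simpa using h1.symm) (.trans (by simpa using h2) ?_)
  simpa [Piece.turn] using h3

theorem bars_turnWord {s t : List Dir} {w : List Piece} (hw : Fits s w t) (hn : NoBar w) :
    Deform TwistMove s t (w ++ bars t) (bars s ++ turnWord w) := by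
  induction w generalizing s with
  | nil =>
    obtain rfl : s = t := hw
    simpa [turnWord] using Deform.refl (fits_bars s)
  | cons p w ih =>
    obtain ⟨rfl, hw⟩ := hw
    have hn := noBar_cons.1 hn
    have h1 := (ih hw hn.2).before (w := [p]) (s := p.bot) ⟨rfl, rfl⟩
    have h2 := (bars_turn_piece p hn.1).after hw.turnWord
    exact .trans (by simpa using h1) (by simpa [turnWord] using h2)

/-! ### Twisted equivalence of virtual knots -/

theorem VirtualDiagram.deform_turnWord_s (D : VirtualDiagram) :
    Deform VirtMove [] [] (turnWord D.word) D.s.word := by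
  have h := turnWord_halfTwist D.closed D.no_bar
  simp only [halfTwist, List.append_nil] at h
  exact h

theorem VirtualLink.toTwisted_s (L : VirtualLink) : L.s.toTwisted = L.toTwisted := by
  induction L using Quot.ind with
  | mk D =>
    have h1 := bars_turnWord D.closed D.no_bar
    have h2 := D.deform_turnWord_s.mono (M' := TwistMove) fun u v h => Or.inl h.1
    simp only [bars, List.append_nil, List.nil_append] at h1
    exact (h1.trans h2).mk_twisted_eq.symm

theorem VirtualDiagram.mk_eq_of_eqvGen {D D' : VirtualDiagram} (hD' : D'.IsKnot)
    (h : Relation.EqvGen TwistedStep D.toTwistedDiagram D'.toTwistedDiagram) :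
    Quot.mk VirtualStep D = Quot.mk VirtualStep D' ∨
      Quot.mk VirtualStep D = Quot.mk VirtualStep D'.s := by
  obtain ⟨V, hV, hDV⟩ := (transport_of_eqvGen h).1 D.word (painting_false D.closed D.no_bar)
  rcases hV.eq_of_isKnot hD' with rfl | rfl
  · exact Or.inl hDV.mk_virtual_eq
  · exact Or.inr (hDV.trans D'.deform_turnWord_s).mk_virtual_eq

end TwistedLinks

theorem theorem1 (L L' : TwistedLinks.VirtualLink) (hL : L.IsKnot) (hL' : L'.IsKnot) :
    L.toTwisted = L'.toTwisted ↔ L' = L ∨ L' = L.s := by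
  constructor
  · intro h
    obtain ⟨D, hD, rfl⟩ := hL
    obtain ⟨D', -, rfl⟩ := hL'
    -- The equality is reversed so that the painting starts on `D'` and arrives on the knot diagram
    -- `D`; thus `s` is applied to `L` and not to `L'`.
    exact TwistedLinks.VirtualDiagram.mk_eq_of_eqvGen hD (Quot.eqvGen_exact h.symm)
  · rintro (rfl | rfl)
    · rfl
    · exact L.toTwisted_s.symm
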